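/- Let $d\in\mathbb N$ and $\hbar\in(0,1]$. For Schwartz functions $f,g\in\mathcal S(\mathbb R^d)$ put $\langle f,g\rangle=\int_{\mathbb R^d} f(y)\overline{g(y)}\,dy$ and $\hat f(\xi)=(2\pi\hbar)^{-d/2}\int_{\mathbb R^d}e^{-\frac{i}{\hbar}\xi\cdot y}f(y)\,dy$. For $u\in\mathcal S'(\mathbb R^d)$ let $\hat u$ be given by $\hat u(\varphi)=u(\hat\varphi)$ and $\overline u$ by $\overline u(\varphi)=\overline{u(\overline\varphi)}$. The Gabor transform of $u\in\mathcal S'(\mathbb R^d)$ with window $g\in\mathcal S(\mathbb R^d)$ is $$V_gu(x,\xi)=u\big(\overline{\pi(x,\xi)g}\big),\qquad \pi(x,\xi)g(y)=(2\pi\hbar)^{-d/2}e^{\frac{i}{\hbar}\xi\cdot y}g(y-x),\qquad (x,\xi)\in\mathbb R^{2d},$$ and $\mathcal V_gu(x,\xi)=\overline{V_g\overline u(x,\xi)}$. The Sjöstrand class $M^{\infty,1}(\mathbb R^d)$ consists of the $u\in\mathcal S'(\mathbb R^d)$ such that $\int_{\mathbb R^d}\sup_{x\in\mathbb R^d}|V_{g_0}u(x,\xi)|\,d\xi<\infty$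 for some $g_0\in\mathcal S(\mathbb R^d)\setminus\{0\}$. For $\omega\in\mathbb R^d$ let $\psi_\omega(y)=(2\pi\hbar)^{-d/2}e^{\frac{i}{\hbar}\omega\cdot y}$ be the pure tone at frequency $\omega$. **Lemma.** Every $f\in M^{\infty,1}(\mathbb R^d)$ is (the distribution given by) a bounded continuous function, again denoted by $f$, and for all $g,\gamma\in\mathcal S(\mathbb R^d)$ with $\langle g,\gamma\rangle\neq0$ and all $t\in\mathbb R^d$ $$f(t)=\frac{1}{\langle\gamma,g\rangle}\int_{\mathbb R^{2d}}V_g\hat f(x,\xi)\,\overline{V_\gamma\psi_{-t}(x,\xi)}\,dx\,d\xi=\frac{1}{\langle\gamma,g\rangle}\int_{\mathbb R^{2d}}V_g\hat f(x,\xi)\,\mathcal V_\gamma\psi_t(x,\xi)\,dx\,d\xi,$$ where both integrals converge absolutely. -/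

import Mathlib

open scoped SchwartzMap ENNReal BoundedContinuousFunction
open MeasureTheory

noncomputable section

namespace Gabor

/-- The Euclidean space `ℝ^d`. -/
abbrev Rd (d : ℕ) : Type := EuclideanSpace ℝ (Fin d)

variable {d : ℕ}

/-- The normalizing factor `(2πħ)^(-d/2)`. -/
def normConst (d : ℕ) (ħ : ℝ) : ℂ := (((2 * Real.pi * ħ) ^ (-(d : ℝ) / 2) : ℝ) : ℂ)

/-- The sesquilinear product `⟨f, g⟩ = ∫ f(y) conj(g(y)) dy` of two Schwartz functions. -/
def pairing (f g : 𝓢(Rd d, ℂ)) : ℂ := ∫ y, f y * starRingEnd ℂ (g y)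

/-! ### Pure tones and phase space shifts -/

/-- The pure tone `ψ_ω(y) = (2πħ)^(-d/2) exp((i/ħ) ω·y)`. -/
def pureTone (ħ : ℝ) (ω y : Rd d) : ℂ :=
  normConst d ħ * Complex.exp (Complex.I / (ħ : ℂ) * ((inner ℝ ω y : ℝ) : ℂ))

theorem hasTemperateGrowth_exp (c : ℝ) :
    Function.HasTemperateGrowth (fun s : ℝ => Complex.exp (Complex.I / (c : ℂ) * (s : ℂ))) := by
  have hd : ∀ n : ℕ, iteratedDeriv n (fun s : ℝ => Complex.exp (Complex.I / (c : ℂ) * (s : ℂ)))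
      = fun s : ℝ => (Complex.I / (c : ℂ)) ^ n * Complex.exp (Complex.I / (c : ℂ) * (s : ℂ)) := by
    intro n
    induction n with
    | zero => simp
    | succ n ih =>
      rw [iteratedDeriv_succ, ih]
      funext s
      have h1 : HasDerivAt (fun s : ℝ => Complex.I / (c : ℂ) * (s : ℂ)) (Complex.I / (c : ℂ)) s := by
        simpa using (Complex.ofRealCLM.hasDerivAt (x := s)).const_mul (Complex.I / (c : ℂ))
      have h2 := (h1.cexp.const_mul ((Complex.I / (c : ℂ)) ^ n)).deriv
      rw [h2]
      ring
  refine ⟨?_, fun n => ⟨0, ‖(Complex.I / (c : ℂ)) ^ n‖, fun s => ?_⟩⟩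
  · exact (contDiff_const.mul Complex.ofRealCLM.contDiff).cexp
  · have hre : (Complex.I / (c : ℂ) * (s : ℂ)) = ((s / c : ℝ) : ℂ) * Complex.I := by
      push_cast; ring
    rw [norm_iteratedFDeriv_eq_norm_iteratedDeriv, hd, norm_mul, hre, Complex.norm_exp_ofReal_mul_I]
    simp

theorem pureTone_hasTemperateGrowth (ħ : ℝ) (ω : Rd d) :
    Function.HasTemperateGrowth (pureTone ħ ω) := by
  have h := (hasTemperateGrowth_exp ħ).comp (Function.hasTemperateGrowth_inner_right ω)
  exact (Function.HasTemperateGrowth.const (normConst d ħ)).mul h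

/-- The pure tone `ψ_ω`, seen as the tempered distribution `φ ↦ ∫ φ(y) ψ_ω(y) dy`. -/
def pureToneDist (ħ : ℝ) (ω : Rd d) : 𝓢'(Rd d, ℂ) :=
  Function.HasTemperateGrowth.toTemperedDistribution volume (pureTone_hasTemperateGrowth ħ ω)

/-- The phase space shift `π(x,ξ) g = M_ξ T_x g` of a Schwartz function. -/
def phaseShift (ħ : ℝ) (x ξ : Rd d) (g : 𝓢(Rd d, ℂ)) : 𝓢(Rd d, ℂ) :=
  SchwartzMap.smulLeftCLM ℂ
    (fun y : Rd d =>
      normConst d ħ * Complex.exp (Complex.I / (ħ : ℂ) * ((inner ℝ ξ y : ℝ) : ℂ)))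
    (SchwartzMap.compSubConstCLM ℂ x g)

theorem phaseShift_apply (ħ : ℝ) (x ξ : Rd d) (g : 𝓢(Rd d, ℂ)) (y : Rd d) :
    phaseShift ħ x ξ g y =
      normConst d ħ * Complex.exp (Complex.I / (ħ : ℂ) * ((inner ℝ ξ y : ℝ) : ℂ)) * g (y - x) :=
  SchwartzMap.smulLeftCLM_apply_apply (pureTone_hasTemperateGrowth ħ ξ) _ y

/-! ### Complex conjugation -/

/-- Pointwise complex conjugation of Schwartz functions, as a continuous real-linear map. -/
def conjS : 𝓢(Rd d, ℂ) →L[ℝ] 𝓢(Rd d, ℂ) :=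
  SchwartzMap.postcompCLM (Complex.conjCLE : ℂ →L[ℝ] ℂ)

theorem conjS_apply (g : 𝓢(Rd d, ℂ)) (y : Rd d) : conjS g y = starRingEnd ℂ (g y) := rfl

theorem conjS_smul (c : ℂ) (g : 𝓢(Rd d, ℂ)) : conjS (c • g) = starRingEnd ℂ c • conjS g := by
  ext y
  simp [conjS_apply]

/-- The complex conjugate of a tempered distribution: `conj(u)(φ) = conj(u(conj φ))`. -/
def conjD (u : 𝓢'(Rd d, ℂ)) : 𝓢'(Rd d, ℂ) :=
  ContinuousLinearMap.toPointwiseConvergenceCLM ℂ (RingHom.id ℂ) 𝓢(Rd d, ℂ) ℂ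
    { toFun := fun φ => starRingEnd ℂ (u (conjS φ))
      map_add' := fun φ χ => by simp
      map_smul' := fun c φ => by simp [conjS_smul]
      cont := Complex.continuous_conj.comp (u.cont.comp conjS.cont) }

theorem conjD_apply (u : 𝓢'(Rd d, ℂ)) (φ : 𝓢(Rd d, ℂ)) :
    conjD u φ = starRingEnd ℂ (u (conjS φ)) := rfl

/-! ### The Gabor transform -/

/-- The Gabor transform `V_g u(x,ξ) = ⟨u, π(x,ξ) g⟩` of a tempered distribution `u`, where
`⟨u, h⟩ = u(conj h)`. -/
def stft (ħ : ℝ) (g : 𝓢(Rd d, ℂ)) (u : 𝓢'(Rd d, ℂ)) (x ξ : Rd d) : ℂ :=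
  u (conjS (phaseShift ħ x ξ g))

/-- The conjugate Gabor transform `𝒱_g u(x,ξ) = conj(V_g (conj u)(x,ξ))`. -/
def stftConj (ħ : ℝ) (g : 𝓢(Rd d, ℂ)) (u : 𝓢'(Rd d, ℂ)) (x ξ : Rd d) : ℂ :=
  starRingEnd ℂ (stft ħ g (conjD u) x ξ)

/-! ### The semiclassical Fourier transform -/

/-- The Fourier transform `f ↦ (2πħ)^(-d/2) ∫ exp(-(i/ħ) ξ·x) f(x) dx` on Schwartz functions,
obtained from Mathlib's normalization by the rescaling `ξ ↦ ξ / (2πħ)`; see `fourierS_apply`. -/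
def fourierS (ħ : ℝ) (hħ : 0 < ħ) : 𝓢(Rd d, ℂ) →L[ℂ] 𝓢(Rd d, ℂ) :=
  normConst d ħ •
    (SchwartzMap.compCLMOfContinuousLinearEquiv ℂ
      (ContinuousLinearEquiv.smulLeft
        (Units.mk0 ((2 * Real.pi * ħ)⁻¹) (by positivity)) : Rd d ≃L[ℝ] Rd d)).comp
    (FourierTransform.fourierCLM ℂ 𝓢(Rd d, ℂ))

theorem fourierS_apply (ħ : ℝ) (hħ : 0 < ħ) (f : 𝓢(Rd d, ℂ)) (ξ : Rd d) :
    fourierS ħ hħ f ξ = normConst d ħ *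
      ∫ x, Complex.exp (-(Complex.I / (ħ : ℂ)) * ((inner ℝ ξ x : ℝ) : ℂ)) * f x := by
  have h : fourierS ħ hħ f ξ =
      normConst d ħ * FourierTransform.fourier (f : Rd d → ℂ) ((2 * Real.pi * ħ)⁻¹ • ξ) := rfl
  rw [h, Real.fourier_eq']
  congr 1
  refine integral_congr_ae (Filter.Eventually.of_forall fun x => ?_)
  have hc : (ħ : ℂ) ≠ 0 := by exact_mod_cast hħ.ne'
  have hp : (Real.pi : ℂ) ≠ 0 := by exact_mod_cast Real.pi_ne_zero
  simp only [inner_smul_right, smul_eq_mul, real_inner_comm x ξ]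
  congr 2
  push_cast
  field_simp

/-- The Fourier transform of a tempered distribution, by duality: `û(φ) = u(φ̂)`. -/
def fourierD (ħ : ℝ) (hħ : 0 < ħ) (u : 𝓢'(Rd d, ℂ)) : 𝓢'(Rd d, ℂ) :=
  PointwiseConvergenceCLM.precomp ℂ (fourierS ħ hħ) u

theorem fourierD_apply (ħ : ℝ) (hħ : 0 < ħ) (u : 𝓢'(Rd d, ℂ)) (φ : 𝓢(Rd d, ℂ)) :
    fourierD ħ hħ u φ = u (fourierS ħ hħ φ) := rfl

/-! ### The Sjöstrand class -/

/-- The norm `∫ sup_x |V_g u(x,ξ)| dξ`, with values in `[0,∞]`. -/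
def sjostrandNorm (ħ : ℝ) (g : 𝓢(Rd d, ℂ)) (u : 𝓢'(Rd d, ℂ)) : ℝ≥0∞ :=
  ∫⁻ ξ, ⨆ x, ‖stft ħ g u x ξ‖ₑ

/-- The Sjöstrand class `M^{∞,1}(ℝ^d)`: tempered distributions whose norm is finite for some
non-zero Schwartz window. -/
def MemSjostrand (ħ : ℝ) (u : 𝓢'(Rd d, ℂ)) : Prop :=
  ∃ g : 𝓢(Rd d, ℂ), g ≠ 0 ∧ sjostrandNorm ħ g u < ∞

/-- The tempered distribution `u` is given by the bounded continuous function `f`. -/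
def IsGivenBy (u : 𝓢'(Rd d, ℂ)) (f : Rd d →ᵇ ℂ) : Prop :=
  ∀ φ : 𝓢(Rd d, ℂ), u φ = ∫ y, f y * φ y

end Gabor

end

/-! A tempered distribution `u`, multiplied by the squared L² norm of a window g₀, is the
superposition of the phase space shifts of g₀ with coefficients V_{g₀}u. This holds weakly
(`windowMass_mul_apply`), because `u` may be moved inside an absolutely convergent integral of
Schwartz functions (`SchwartzMap.integral_comp_comm`). If V_{g₀}u is dominated by an integrable
function of ξ alone, the superposition also converges absolutely at every point. Dominated
convergence makes it a bounded continuous function, and Fubini identifies it with `u`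
(`isGivenBy_synthesis`).

For the formula, the Fourier transform rotates phase space: up to a unimodular factor, V_g û(x,ξ) is
V_h u(-ξ,x), where conj(h) is the Fourier transform of conj(g) (`stft_fourierD`). The conjugated
Gabor transform of the pure tone is a plane wave in x times the inverse Fourier transform of γ at
ξ+t. The unimodular factors combine to exp((i/ħ) t·x). Hence the x-integral is a Fourier inversion
at t and gives f(t) conj(h(t+ξ)); the remaining ξ-integral is f(t)⟨γ,g⟩ by Parseval.

Absolute convergence needs V_h u to be dominated in its frequency variable for a window h dictated
by g, so finiteness of the Sjöstrand norm must not depend on the window (`sjostrandNorm_lt_top`).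
This follows from a convolution estimate. -/

noncomputable section

namespace SchwartzMap

/-! ### Weighted derivatives as maps from Schwartz space to Banach spaces. -/

section Generalities

variable {E : Type*} [NormedAddCommGroup E] [NormedSpace ℝ E]

/-- Bounded continuous functions with values in the `n`-linear forms on `E`. -/
def DerivSpace (E : Type*) [NormedAddCommGroup E] [NormedSpace ℝ E] (n : ℕ) : Type _ :=
  E →ᵇ ContinuousMultilinearMap ℝ (fun _ : Fin n => E) ℂ

instance (n : ℕ) : NormedAddCommGroup (DerivSpace E n) :=
  inferInstanceAs (NormedAddCommGroup (E →ᵇ ContinuousMultilinearMap ℝ (fun _ : Fin n => E) ℂ))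

instance (n : ℕ) : NormedSpace ℂ (DerivSpace E n) :=
  inferInstanceAs (NormedSpace ℂ (E →ᵇ ContinuousMultilinearMap ℝ (fun _ : Fin n => E) ℂ))

instance (n : ℕ) : CompleteSpace (DerivSpace E n) :=
  inferInstanceAs (CompleteSpace (E →ᵇ ContinuousMultilinearMap ℝ (fun _ : Fin n => E) ℂ))

/-- Evaluation at a point. -/
def DerivSpace.evalCLM (n : ℕ) (y : E) :
    DerivSpace E n →L[ℂ] ContinuousMultilinearMap ℝ (fun _ : Fin n => E) ℂ :=
  (BoundedContinuousFunction.evalCLM ℂ y :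
    (E →ᵇ ContinuousMultilinearMap ℝ (fun _ : Fin n => E) ℂ) →L[ℂ] _)

theorem DerivSpace.ext_eval {n : ℕ} {F G : DerivSpace E n}
    (h : ∀ y, DerivSpace.evalCLM n y F = DerivSpace.evalCLM n y G) : F = G :=
  BoundedContinuousFunction.ext h

theorem DerivSpace.norm_le {n : ℕ} {F : DerivSpace E n} {C : ℝ} (hC : 0 ≤ C) :
    ‖F‖ ≤ C ↔ ∀ y, ‖DerivSpace.evalCLM n y F‖ ≤ C :=
  BoundedContinuousFunction.norm_le hC

/-- The map `f ↦ ‖y‖ ^ k • D^n f(y)` from Schwartz functions to bounded continuous functions. -/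
def weightedDerivCLM (E : Type*) [NormedAddCommGroup E] [NormedSpace ℝ E] (k n : ℕ) :
    𝓢(E, ℂ) →L[ℂ] (DerivSpace E n) :=
  mkCLMtoNormedSpace (σ := RingHom.id ℂ) (D := E) (E := ℂ) (G := DerivSpace E n)
    (fun f => BoundedContinuousFunction.ofNormedAddCommGroup
      (fun y => (‖y‖ ^ k : ℝ) • iteratedFDeriv ℝ n f y)
      ((continuous_norm.pow k).smul
        ((f.smooth n).continuous_iteratedFDeriv (by exact_mod_cast le_rfl)))
      (SchwartzMap.seminorm ℂ k n f) (fun y => by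
        rw [norm_smul, Real.norm_of_nonneg (by positivity)]
        exact le_seminorm ℂ k n f y))
    (fun f g => DerivSpace.ext_eval fun y => by
      have h := iteratedFDeriv_add_apply (x := y) ((f.smooth n).contDiffAt) ((g.smooth n).contDiffAt)
      exact (congrArg (fun v => (‖y‖ ^ k : ℝ) • v) h).trans (smul_add _ _ _))
    (fun a f => DerivSpace.ext_eval fun y => by
      have h := iteratedFDeriv_const_smul_apply (x := y) (a := a) ((f.smooth n).contDiffAt)
      exact (congrArg (fun v => (‖y‖ ^ k : ℝ) • v) h).trans (smul_comm _ _ _))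
    ⟨{(k, n)}, 1, zero_le_one, fun f => by
      simp only [Finset.sup_singleton, one_mul]
      refine (DerivSpace.norm_le (apply_nonneg _ _)).2 fun y => ?_
      have h : ‖(‖y‖ ^ k : ℝ) • iteratedFDeriv ℝ n f y‖ ≤ SchwartzMap.seminorm ℂ k n f := by
        rw [norm_smul, Real.norm_of_nonneg (by positivity)]
        exact le_seminorm ℂ k n f y
      exact h⟩

theorem evalCLM_weightedDerivCLM (k n : ℕ) (f : 𝓢(E, ℂ)) (y : E) :
    DerivSpace.evalCLM n y (weightedDerivCLM E k n f)
      = (‖y‖ ^ k : ℝ) • iteratedFDeriv ℝ n f y := rfl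

theorem norm_weightedDerivCLM_le (k n : ℕ) (f : 𝓢(E, ℂ)) :
    ‖weightedDerivCLM E k n f‖ ≤ SchwartzMap.seminorm ℂ k n f :=
  (DerivSpace.norm_le (apply_nonneg _ _)).2 fun y => by
    rw [evalCLM_weightedDerivCLM, norm_smul, Real.norm_of_nonneg (by positivity)]
    exact le_seminorm ℂ k n f y

theorem seminorm_le_norm_weightedDerivCLM (k n : ℕ) (f : 𝓢(E, ℂ)) :
    SchwartzMap.seminorm ℂ k n f ≤ ‖weightedDerivCLM E k n f‖ := by
  refine seminorm_le_bound ℂ k n f (norm_nonneg _) fun y => ?_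
  have h := (DerivSpace.norm_le (norm_nonneg (weightedDerivCLM E k n f))).1 le_rfl y
  rwa [evalCLM_weightedDerivCLM, norm_smul, Real.norm_of_nonneg (by positivity)] at h

/-! ### Exchanging tempered distributions with integrals. -/

section Exchange

variable {Z : Type*} [MeasurableSpace Z] {μ : Measure Z}

/-- A continuous functional that is bounded by the norm of a map into a Banach space commutes
with every integral that this map commutes with. -/
theorem integral_comp_comm_of_norm_le {X B : Type*} [AddCommGroup X] [Module ℂ X]
    [NormedAddCommGroup B] [NormedSpace ℂ B] [CompleteSpace B]
    (ι : X →ₗ[ℂ] B) (u : X →ₗ[ℂ] ℂ) (C : ℝ) (hbd : ∀ f, ‖u f‖ ≤ C * ‖ι f‖)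
    {K : Z → X} {Φ : X} (hι : Integrable (fun z => ι (K z)) μ)
    (hΦι : ι Φ = ∫ z, ι (K z) ∂μ) :
    Integrable (fun z => u (K z)) μ ∧ u Φ = ∫ z, u (K z) ∂μ := by
  -- The bound makes `u` vanish on the kernel of `ι`, so `u` factors through the range of `ι` as a
  -- bounded functional. Hahn–Banach extends that functional to the whole Banach space, where it
  -- commutes with Bochner integrals.
  have hker : LinearMap.ker ι ≤ LinearMap.ker u := by
    intro f hf
    have h0 : ι f = 0 := hf
    have := hbd f
    rw [h0, norm_zero, mul_zero] at this
    exact norm_le_zero_iff.1 this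
  let ℓ : LinearMap.range ι →ₗ[ℂ] ℂ :=
    ((LinearMap.ker ι).liftQ u hker).comp ι.quotKerEquivRange.symm.toLinearMap
  have hℓ : ∀ f, ℓ ⟨ι f, f, rfl⟩ = u f := by
    intro f
    have : ι.quotKerEquivRange.symm ⟨ι f, f, rfl⟩ = Submodule.Quotient.mk f := by
      rw [LinearEquiv.symm_apply_eq]
      rfl
    simp [ℓ, this]
  let L : StrongDual ℂ (LinearMap.range ι) := ℓ.mkContinuous C (by
    rintro ⟨_, f, rfl⟩
    exact (congrArg norm (hℓ f)).trans_le (hbd f))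
  obtain ⟨g, hg, -⟩ := exists_extension_norm_eq _ L
  have hgu : ∀ f, g (ι f) = u f := fun f => (hg ⟨ι f, f, rfl⟩).trans (hℓ f)
  have hi := g.integrable_comp hι
  have he := g.integral_comp_comm hι
  simp_rw [hgu] at hi he
  rw [he, ← hΦι, hgu]
  exact ⟨hi, rfl⟩

variable [TopologicalSpace Z]


omit [MeasurableSpace Z] in
theorem continuous_iteratedFDeriv_apply {K : Z → 𝓢(E, ℂ)} (hK : Continuous K) (n : ℕ) (y : E) :
    Continuous fun z => iteratedFDeriv ℝ n (K z) y := by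
  have h1 : Continuous fun z => DerivSpace.evalCLM n y (weightedDerivCLM E 0 n (K z)) :=
    (DerivSpace.evalCLM n y).continuous.comp ((weightedDerivCLM E 0 n).continuous.comp hK)
  simpa [evalCLM_weightedDerivCLM] using h1

variable [SecondCountableTopology Z] [OpensMeasurableSpace Z]

/-- Differentiation under the integral sign, evaluated at a vector. -/
theorem fderiv_integral_apply {G : Type*} [NormedAddCommGroup G] [NormedSpace ℝ G]
    {F : E → Z → G} (hF : ∀ x, Continuous (F x)) (hF' : ∀ x, Continuous fun z => fderiv ℝ (F · z) x)
    (hd : ∀ z, Differentiable ℝ (F · z)) {b b' : Z → ℝ} (hb : Integrable b μ)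
    (hb' : Integrable b' μ) (hFb : ∀ x z, ‖F x z‖ ≤ b z) (hFb' : ∀ x z, ‖fderiv ℝ (F · z) x‖ ≤ b' z)
    (y v : E) :
    fderiv ℝ (fun x => ∫ z, F x z ∂μ) y v = ∫ z, fderiv ℝ (F · z) y v ∂μ := by
  have key := hasFDerivAt_integral_of_dominated_of_fderiv_le (𝕜 := ℝ) (μ := μ)
      (F := F) (F' := fun x z => fderiv ℝ (F · z) x) (x₀ := y)
      (s := Set.univ) (bound := b') Filter.univ_mem
      (Filter.Eventually.of_forall fun x => (hF x).aestronglyMeasurable)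
      (hb.mono' (hF y).aestronglyMeasurable (Filter.Eventually.of_forall fun z => hFb y z))
      (hF' y).aestronglyMeasurable
      (Filter.Eventually.of_forall fun z x _ => hFb' x z) hb'
      (Filter.Eventually.of_forall fun z x _ => (hd z x).hasFDerivAt)
  rw [key.fderiv, ContinuousLinearMap.integral_apply]
  exact hb'.mono' (hF' y).aestronglyMeasurable (Filter.Eventually.of_forall fun z => hFb' y z)

theorem integrable_iteratedFDeriv {K : Z → 𝓢(E, ℂ)} (hK : Continuous K) (n : ℕ)
    (hint : Integrable (fun z => SchwartzMap.seminorm ℂ 0 n (K z)) μ) (y : E) :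
    Integrable (fun z => iteratedFDeriv ℝ n (K z) y) μ :=
  hint.mono' (continuous_iteratedFDeriv_apply hK n y).aestronglyMeasurable
    (Filter.Eventually.of_forall fun z => norm_iteratedFDeriv_le_seminorm ℂ (K z) n y)

/-- Induction on the order: the integrable seminorms of orders (0, n) and (0, n+1) dominate the
integrand and its derivative uniformly in the point. -/
theorem iteratedFDeriv_eq_integral {K : Z → 𝓢(E, ℂ)} (hK : Continuous K)
    (hint : ∀ k n, Integrable (fun z => SchwartzMap.seminorm ℂ k n (K z)) μ)
    {Φ : 𝓢(E, ℂ)} (hΦ : ∀ y, Φ y = ∫ z, K z y ∂μ) (n : ℕ) (y : E) :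
    iteratedFDeriv ℝ n Φ y = ∫ z, iteratedFDeriv ℝ n (K z) y ∂μ := by
  induction n generalizing y with
  | zero =>
    ext m
    rw [ContinuousMultilinearMap.integral_apply (integrable_iteratedFDeriv hK 0 (hint 0 0) y)]
    simpa using hΦ y
  | succ n ih =>
    have hcont : ∀ x, Continuous fun z => fderiv ℝ (iteratedFDeriv ℝ n (K z)) x := by
      intro x
      have h1 : (fun z => fderiv ℝ (iteratedFDeriv ℝ n (K z)) x)
          = fun z => continuousMultilinearCurryLeftEquiv ℝ (fun _ : Fin (n + 1) => E) ℂ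
            (iteratedFDeriv ℝ (n + 1) (K z) x) := by
        funext z
        rw [iteratedFDeriv_succ_eq_comp_left]
        simp
      rw [h1]
      exact (continuousMultilinearCurryLeftEquiv ℝ (fun _ : Fin (n + 1) => E) ℂ).continuous.comp
        (continuous_iteratedFDeriv_apply hK (n + 1) x)
    ext m
    rw [iteratedFDeriv_succ_apply_left, funext ih, fderiv_integral_apply (μ := μ)
      (F := fun x z => iteratedFDeriv ℝ n (K z) x)
      (fun x => continuous_iteratedFDeriv_apply hK n x) hcont
      (fun z => ((K z).smooth (n + 1)).differentiable_iteratedFDeriv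
          (by exact_mod_cast Nat.lt_succ_self n)) (hint 0 n) (hint 0 (n + 1))
      (fun x z => norm_iteratedFDeriv_le_seminorm ℂ (K z) n x)
      (fun x z => by
        rw [norm_fderiv_iteratedFDeriv]
        exact norm_iteratedFDeriv_le_seminorm ℂ (K z) (n + 1) x),
      ContinuousMultilinearMap.integral_apply (integrable_iteratedFDeriv hK _ (hint 0 (n + 1)) y)]
    rw [ContinuousMultilinearMap.integral_apply]
    · rfl
    · refine (hint 0 (n + 1)).norm.mul_const ‖m 0‖ |>.mono' ?_ ?_
      · exact Continuous.aestronglyMeasurable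
          ((ContinuousLinearMap.apply ℝ _ (m 0)).continuous.comp (hcont y))
      · refine Filter.Eventually.of_forall fun z => ?_
        refine ((fderiv ℝ (iteratedFDeriv ℝ n (K z)) y).le_opNorm (m 0)).trans ?_
        gcongr
        rw [norm_fderiv_iteratedFDeriv]
        exact (norm_iteratedFDeriv_le_seminorm ℂ (K z) (n + 1) y).trans (le_abs_self _)

/-- A tempered distribution commutes with absolutely convergent integrals of Schwartz functions. -/
theorem integral_comp_comm {K : Z → 𝓢(E, ℂ)} (hK : Continuous K)
    (hint : ∀ k n, Integrable (fun z => SchwartzMap.seminorm ℂ k n (K z)) μ)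
    {Φ : 𝓢(E, ℂ)} (hΦ : ∀ y, Φ y = ∫ z, K z y ∂μ) (u : 𝓢(E, ℂ) →L[ℂ] ℂ) :
    Integrable (fun z => u (K z)) μ ∧ u Φ = ∫ z, u (K z) ∂μ := by
  -- Continuity of `u` involves only finitely many Schwartz seminorms, so a finite product of Banach
  -- spaces suffices in place of the Fréchet space.
  obtain ⟨s, C, -, hC⟩ := Seminorm.bound_of_continuous (schwartz_withSeminorms ℂ E ℂ)
    ((normSeminorm ℂ ℂ).comp u.toLinearMap) (continuous_norm.comp u.continuous)
  let ι : 𝓢(E, ℂ) →L[ℂ] (∀ i : s, DerivSpace E i.1.2) :=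
    ContinuousLinearMap.pi fun i => weightedDerivCLM E i.1.1 i.1.2
  have hι : Integrable (fun z => ι (K z)) μ := by
    refine (integrable_finsetSum (Finset.univ : Finset s)
      (fun i _ => hint i.1.1 i.1.2)).mono'
      (ι.continuous.comp hK).aestronglyMeasurable (Filter.Eventually.of_forall fun z => ?_)
    refine (pi_norm_le_iff_of_nonneg (Finset.sum_nonneg fun _ _ => apply_nonneg _ _)).2
      fun i => (norm_weightedDerivCLM_le _ _ _).trans ?_
    exact Finset.single_le_sum (f := fun i : s => SchwartzMap.seminorm ℂ i.1.1 i.1.2 (K z))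
      (fun _ _ => apply_nonneg _ _) (Finset.mem_univ i)
  refine integral_comp_comm_of_norm_le ι.toLinearMap u.toLinearMap C (fun f => ?_) hι ?_
  · refine (hC f).trans ?_
    rw [smul_apply, NNReal.smul_def, smul_eq_mul]
    refine mul_le_mul_of_nonneg_left ?_ C.2
    refine Seminorm.finset_sup_apply_le (norm_nonneg _) fun i hi => ?_
    exact (seminorm_le_norm_weightedDerivCLM i.1 i.2 f).trans
      (norm_le_pi_norm (ι f) ⟨i, hi⟩)
  · funext i
    have h3 : ι Φ i = ∫ z, ι (K z) i ∂μ := by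
      -- The Bochner integral in the function space is identified by evaluating at points, where the
      -- claim is differentiation under the integral sign.
      refine DerivSpace.ext_eval fun y => ?_
      let A : DerivSpace E i.1.2 →L[ℂ] (E [×i.1.2]→L[ℝ] ℂ) := DerivSpace.evalCLM i.1.2 y
      have h1 := A.integral_comp_comm
        (((ContinuousLinearMap.proj (R := ℂ) (φ := fun i : s => DerivSpace E i.1.2) i).integrable_comp hι))
      have h2 : A (ι Φ i) = ∫ z, A (ι (K z) i) ∂μ := by
        change (‖y‖ ^ i.1.1 : ℝ) • iteratedFDeriv ℝ i.1.2 Φ y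
          = ∫ z, (‖y‖ ^ i.1.1 : ℝ) • iteratedFDeriv ℝ i.1.2 (K z) y ∂μ
        rw [integral_smul, iteratedFDeriv_eq_integral hK hint hΦ]
      exact h2.trans h1
    exact h3.trans ((ContinuousLinearMap.proj (R := ℂ) (φ := fun i : s => DerivSpace E i.1.2) i).integral_comp_comm hι)

end Exchange

end Generalities

/-! ### Translates of Schwartz functions and their products: growth, continuity, decay. -/

section Translation

variable {E : Type*} [NormedAddCommGroup E] [NormedSpace ℝ E]

theorem iteratedFDeriv_compSubConstCLM (a : 𝓢(E, ℂ)) (w y : E) (n : ℕ) :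
    iteratedFDeriv ℝ n (compSubConstCLM ℂ w a) y = iteratedFDeriv ℝ n a (y - w) :=
  iteratedFDeriv_comp_sub (f := a) n w y

/-- Rapid decay of the derivatives of a Schwartz function. -/
theorem exists_one_add_pow_mul_iteratedFDeriv_le (a : 𝓢(E, ℂ)) (k n : ℕ) :
    ∃ C, 0 ≤ C ∧ ∀ j ≤ n, ∀ y, (1 + ‖y‖) ^ k * ‖iteratedFDeriv ℝ j a y‖ ≤ C :=
  ⟨2 ^ k * (Finset.Iic (k, n)).sup (fun m => SchwartzMap.seminorm ℂ m.1 m.2) a,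
    mul_nonneg (by positivity) (apply_nonneg _ _),
    fun _ hj y => one_add_le_sup_seminorm_apply (m := (k, n)) le_rfl hj a y⟩

theorem norm_comp_neg_id_le {G : Type*} [NormedAddCommGroup G] [NormedSpace ℝ G]
    (L : E →L[ℝ] G) : ‖L.comp (-ContinuousLinearMap.id ℝ E)‖ ≤ ‖L‖ :=
  ContinuousLinearMap.opNorm_le_bound _ (norm_nonneg _) fun v => by
    simpa using L.le_opNorm (-v)

omit [NormedSpace ℝ E] in
theorem one_add_norm_le (y w : E) : 1 + ‖y‖ ≤ (1 + ‖w‖) * (1 + ‖y - w‖) := by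
  have h : ‖y‖ ≤ ‖y - w‖ + ‖w‖ := by simpa using norm_add_le (y - w) w
  nlinarith [norm_nonneg w, norm_nonneg (y - w)]

/-- The weight at y is at most the weight at y-w, absorbed by the decay of `a`, times the weight at
w. -/
theorem seminorm_compSubConstCLM_le (a : 𝓢(E, ℂ)) (k n : ℕ) :
    ∃ C, 0 ≤ C ∧ ∀ w, SchwartzMap.seminorm ℂ k n (compSubConstCLM ℂ w a) ≤ C * (1 + ‖w‖) ^ k := by
  obtain ⟨C, hC0, hC⟩ := exists_one_add_pow_mul_iteratedFDeriv_le a k n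
  refine ⟨C, hC0, fun w => seminorm_le_bound ℂ k n _ (by positivity) fun y => ?_⟩
  rw [iteratedFDeriv_compSubConstCLM]
  calc ‖y‖ ^ k * ‖iteratedFDeriv ℝ n a (y - w)‖
      ≤ ((1 + ‖w‖) * (1 + ‖y - w‖)) ^ k * ‖iteratedFDeriv ℝ n a (y - w)‖ := by
        gcongr
        linarith [one_add_norm_le y w]
    _ = (1 + ‖w‖) ^ k * ((1 + ‖y - w‖) ^ k * ‖iteratedFDeriv ℝ n a (y - w)‖) := by
        rw [mul_pow]; ring
    _ ≤ (1 + ‖w‖) ^ k * C := by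
        gcongr
        exact hC n le_rfl _
    _ = C * (1 + ‖w‖) ^ k := mul_comm _ _

/-- A continuous seminorm of a translate grows at most polynomially. -/
theorem continuousSeminorm_compSubConstCLM_le (q : Seminorm ℂ 𝓢(E, ℂ)) (hq : Continuous q)
    (a : 𝓢(E, ℂ)) :
    ∃ C, ∃ m : ℕ, 0 ≤ C ∧ ∀ w, q (compSubConstCLM ℂ w a) ≤ C * (1 + ‖w‖) ^ m := by
  obtain ⟨s, D, -, hD⟩ := Seminorm.bound_of_continuous (schwartz_withSeminorms ℂ E ℂ) q hq
  choose C hC0 hC using fun i : ℕ × ℕ => seminorm_compSubConstCLM_le a i.1 i.2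
  have hle : ∀ i ∈ s, i.1 ≤ s.sup Prod.fst := fun i hi => Finset.le_sup (f := Prod.fst) hi
  refine ⟨D * ∑ i ∈ s, C i, s.sup Prod.fst,
    mul_nonneg D.2 (Finset.sum_nonneg fun i _ => hC0 i), fun w => (hD _).trans ?_⟩
  rw [smul_apply, NNReal.smul_def, smul_eq_mul, mul_assoc]
  refine mul_le_mul_of_nonneg_left ?_ D.2
  refine Seminorm.finset_sup_apply_le
    (mul_nonneg (Finset.sum_nonneg fun i _ => hC0 i) (by positivity)) fun i hi => ?_
  refine (hC i w).trans ?_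
  have h1 : C i ≤ ∑ i ∈ s, C i := Finset.single_le_sum (fun i _ => hC0 i) hi
  have h2 : (1 + ‖w‖) ^ i.1 ≤ (1 + ‖w‖) ^ s.sup Prod.fst :=
    pow_le_pow_right₀ (by linarith [norm_nonneg w]) (hle i hi)
  exact mul_le_mul h1 h2 (by positivity) (Finset.sum_nonneg fun i _ => hC0 i)

/-- Translation is continuous in the Schwartz topology. -/
theorem continuous_compSubConstCLM (a : 𝓢(E, ℂ)) :
    Continuous fun w : E => compSubConstCLM ℂ w a := by
  refine continuous_iff_continuousAt.2 fun w₀ => ?_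
  refine ((schwartz_withSeminorms ℂ E ℂ).tendsto_nhds _ _).2 ?_
  rintro ⟨k, n⟩ ε hε
  -- The mean value inequality costs one derivative. On the unit ball around `w₀` the polynomial
  -- growth in the translation is bounded by `M`.
  obtain ⟨C, hC0, hC⟩ := seminorm_compSubConstCLM_le a k (n + 1)
  set M := C * (1 + (‖w₀‖ + 1)) ^ k with hM
  have hM0 : 0 ≤ M := by positivity
  have key : ∀ w ∈ Metric.ball w₀ 1,
      SchwartzMap.seminorm ℂ k n (compSubConstCLM ℂ w a - compSubConstCLM ℂ w₀ a)
        ≤ M * ‖w - w₀‖ := by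
    intro w hw
    refine seminorm_le_bound ℂ k n _ (by positivity) fun y => ?_
    have hsub : iteratedFDeriv ℝ n (compSubConstCLM ℂ w a - compSubConstCLM ℂ w₀ a : 𝓢(E, ℂ)) y
        = iteratedFDeriv ℝ n a (y - w) - iteratedFDeriv ℝ n a (y - w₀) := by
      rw [← iteratedFDeriv_compSubConstCLM, ← iteratedFDeriv_compSubConstCLM]
      exact iteratedFDeriv_sub_apply ((smooth _ n).contDiffAt) ((smooth _ n).contDiffAt)
    rw [hsub]
    have hdiff : Differentiable ℝ (iteratedFDeriv ℝ n a) :=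
      (a.smooth (n + 1)).differentiable_iteratedFDeriv (by exact_mod_cast Nat.lt_succ_self n)
    have hfd : ∀ x, HasFDerivAt (fun x => iteratedFDeriv ℝ n a (y - x))
        ((fderiv ℝ (iteratedFDeriv ℝ n a) (y - x)).comp (-ContinuousLinearMap.id ℝ E)) x := by
      intro x
      exact (hdiff (y - x)).hasFDerivAt.comp x ((hasFDerivAt_id x).const_sub y)
    -- The Lipschitz constant used below is `M / ‖y‖ ^ k`, which is meaningful only for a nonzero
    -- weight.
    by_cases hy : ‖y‖ ^ k = 0
    · rw [hy, zero_mul]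
      positivity
    have hy' : 0 < ‖y‖ ^ k := lt_of_le_of_ne (by positivity) (Ne.symm hy)
    have hmv := (convex_ball w₀ 1).norm_image_sub_le_of_norm_hasFDerivWithin_le (𝕜 := ℝ)
      (C := M / ‖y‖ ^ k) (fun x _ => (hfd x).hasFDerivWithinAt) (fun x hx => ?_)
      (Metric.mem_ball_self one_pos) hw
    · calc _ ≤ ‖y‖ ^ k * (M / ‖y‖ ^ k * ‖w - w₀‖) := by gcongr
        _ = M * ‖w - w₀‖ := by field_simp
    · rw [le_div_iff₀ hy', mul_comm]
      have h1 : ‖(fderiv ℝ (iteratedFDeriv ℝ n a) (y - x)).comp (-ContinuousLinearMap.id ℝ E)‖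
          ≤ ‖iteratedFDeriv ℝ (n + 1) a (y - x)‖ := by
        rw [← norm_fderiv_iteratedFDeriv]
        exact norm_comp_neg_id_le _
      have h2 := le_seminorm ℂ k (n + 1) (compSubConstCLM ℂ x a) y
      rw [iteratedFDeriv_compSubConstCLM] at h2
      have hx' : ‖x‖ ≤ ‖w₀‖ + 1 := by
        have := norm_le_norm_add_norm_sub' x w₀
        have h3 : ‖x - w₀‖ < 1 := by simpa [dist_eq_norm] using hx
        linarith
      calc _ ≤ ‖y‖ ^ k * ‖iteratedFDeriv ℝ (n + 1) a (y - x)‖ := by gcongr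
        _ ≤ _ := h2
        _ ≤ _ := hC x
        _ ≤ M := by rw [hM]; gcongr
  have ht : Filter.Tendsto (fun w => M * ‖w - w₀‖) (nhds w₀) (nhds 0) := by
    have : Continuous fun w => M * ‖w - w₀‖ := by fun_prop
    simpa using this.tendsto w₀
  filter_upwards [Metric.ball_mem_nhds w₀ one_pos, ht.eventually (gt_mem_nhds hε)] with w h1 h2
  exact (key w h1).trans_lt h2

/-- The product of two Schwartz functions. -/
def mulS (a b : 𝓢(E, ℂ)) : 𝓢(E, ℂ) := SchwartzMap.pairing (ContinuousLinearMap.mul ℂ ℂ) a b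

theorem mulS_apply (a b : 𝓢(E, ℂ)) (y : E) : mulS a b y = a y * b y := rfl

theorem continuous_mulS_left (b : 𝓢(E, ℂ)) : Continuous fun a => mulS a b :=
  pairing_continuous_left _ b

/-- By Leibniz, each term pairs a derivative of `a` at y-w with one of `b` at y. Since 1+‖w‖ ≤
(1+‖y‖)(1+‖y-w‖), m powers are charged to each factor; `b` also pays for the weight of order k. -/
theorem seminorm_mulS_compSubConstCLM_le (a b : 𝓢(E, ℂ)) (k n m : ℕ) :
    ∃ C, 0 ≤ C ∧ ∀ w,
      (1 + ‖w‖) ^ m * SchwartzMap.seminorm ℂ k n (mulS (compSubConstCLM ℂ w a) b) ≤ C := by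
  obtain ⟨A, hA0, hA⟩ := exists_one_add_pow_mul_iteratedFDeriv_le a m n
  obtain ⟨B, hB0, hB⟩ := exists_one_add_pow_mul_iteratedFDeriv_le b (m + k) n
  refine ⟨∑ i ∈ Finset.range (n + 1), (n.choose i : ℝ) * (A * B),
    Finset.sum_nonneg fun i _ => by positivity, fun w => ?_⟩
  have hw : 0 < (1 + ‖w‖) ^ m := by positivity
  rw [mul_comm, ← le_div_iff₀ hw]
  refine seminorm_le_bound ℂ k n _
    (div_nonneg (Finset.sum_nonneg fun i _ => by positivity) hw.le) fun y => ?_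
  rw [le_div_iff₀ hw]
  have h1 := norm_iteratedFDeriv_mul_le (n := n) ((compSubConstCLM ℂ w a).smooth n) (b.smooth n) y
    le_rfl
  calc ‖y‖ ^ k * ‖iteratedFDeriv ℝ n (mulS (compSubConstCLM ℂ w a) b) y‖ * (1 + ‖w‖) ^ m
      ≤ ‖y‖ ^ k * (∑ i ∈ Finset.range (n + 1), (n.choose i : ℝ) *
          ‖iteratedFDeriv ℝ i (compSubConstCLM ℂ w a) y‖ * ‖iteratedFDeriv ℝ (n - i) b y‖)
          * (1 + ‖w‖) ^ m := by
        gcongr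
        exact h1
    _ = ∑ i ∈ Finset.range (n + 1), (n.choose i : ℝ) * ((1 + ‖w‖) ^ m * (‖y‖ ^ k *
          (‖iteratedFDeriv ℝ i a (y - w)‖ * ‖iteratedFDeriv ℝ (n - i) b y‖))) := by
        rw [Finset.mul_sum, Finset.sum_mul]
        refine Finset.sum_congr rfl fun i _ => ?_
        rw [iteratedFDeriv_compSubConstCLM]
        ring
    _ ≤ _ := by
        refine Finset.sum_le_sum fun i hi => mul_le_mul_of_nonneg_left ?_ (by positivity)
        have hi' : i ≤ n := Nat.lt_succ_iff.1 (Finset.mem_range.1 hi)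
        have hw' : 1 + ‖w‖ ≤ (1 + ‖y‖) * (1 + ‖y - w‖) := by
          simpa [norm_sub_rev] using one_add_norm_le w y
        calc (1 + ‖w‖) ^ m * (‖y‖ ^ k *
              (‖iteratedFDeriv ℝ i a (y - w)‖ * ‖iteratedFDeriv ℝ (n - i) b y‖))
            ≤ ((1 + ‖y‖) * (1 + ‖y - w‖)) ^ m * ((1 + ‖y‖) ^ k *
              (‖iteratedFDeriv ℝ i a (y - w)‖ * ‖iteratedFDeriv ℝ (n - i) b y‖)) := by
              gcongr
              linarith
          _ = ((1 + ‖y - w‖) ^ m * ‖iteratedFDeriv ℝ i a (y - w)‖) *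
              ((1 + ‖y‖) ^ (m + k) * ‖iteratedFDeriv ℝ (n - i) b y‖) := by
              rw [mul_pow, pow_add]; ring
          _ ≤ A * B := by
              gcongr
              · exact hA i hi' _
              · exact hB _ (Nat.sub_le _ _) _

/-- A continuous seminorm of the product of a Schwartz function with a translate of another one
decays rapidly in the translation parameter. -/
theorem continuousSeminorm_mulS_compSubConstCLM_le (q : Seminorm ℂ 𝓢(E, ℂ)) (hq : Continuous q)
    (a b : 𝓢(E, ℂ)) (m : ℕ) :
    ∃ C, 0 ≤ C ∧ ∀ w, (1 + ‖w‖) ^ m * q (mulS (compSubConstCLM ℂ w a) b) ≤ C := by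
  obtain ⟨s, D, -, hD⟩ := Seminorm.bound_of_continuous (schwartz_withSeminorms ℂ E ℂ) q hq
  choose C hC0 hC using fun i : ℕ × ℕ => seminorm_mulS_compSubConstCLM_le a b i.1 i.2 m
  refine ⟨D * ∑ i ∈ s, C i, mul_nonneg D.2 (Finset.sum_nonneg fun i _ => hC0 i), fun w => ?_⟩
  have hw : 0 < (1 + ‖w‖) ^ m := by positivity
  rw [mul_comm, ← le_div_iff₀ hw, mul_div_assoc]
  refine (hD _).trans ?_
  rw [smul_apply, NNReal.smul_def, smul_eq_mul]
  refine mul_le_mul_of_nonneg_left ?_ D.2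
  refine Seminorm.finset_sup_apply_le
    (div_nonneg (Finset.sum_nonneg fun i _ => hC0 i) hw.le) fun i hi => ?_
  rw [le_div_iff₀ hw, mul_comm]
  exact (hC i w).trans (Finset.single_le_sum (fun i _ => hC0 i) hi)

end Translation

end SchwartzMap

namespace Gabor

open SchwartzMap (mulS mulS_apply)

variable {d : ℕ}

/-! ### Plane waves -/

/-- The plane wave `exp((i/ħ) ξ·y)`. -/
def wave (ħ : ℝ) (ξ y : Rd d) : ℂ :=
  Complex.exp (Complex.I / (ħ : ℂ) * ((inner ℝ ξ y : ℝ) : ℂ))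

theorem wave_comm (ħ : ℝ) (ξ y : Rd d) : wave ħ ξ y = wave ħ y ξ := by
  rw [wave, wave, real_inner_comm]

theorem wave_eq_exp_mul_I (ħ : ℝ) (ξ y : Rd d) :
    wave ħ ξ y = Complex.exp (((inner ℝ ξ y / ħ : ℝ) : ℂ) * Complex.I) := by
  rw [wave]
  congr 1
  push_cast
  ring

theorem norm_wave (ħ : ℝ) (ξ y : Rd d) : ‖wave ħ ξ y‖ = 1 := by
  rw [wave_eq_exp_mul_I, Complex.norm_exp_ofReal_mul_I]

theorem conj_wave (ħ : ℝ) (ξ y : Rd d) : starRingEnd ℂ (wave ħ ξ y) = wave ħ (-ξ) y := by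
  rw [wave_eq_exp_mul_I, wave_eq_exp_mul_I, ← Complex.exp_conj]
  congr 1
  simp [neg_div]

theorem wave_add_left (ħ : ℝ) (ξ η y : Rd d) : wave ħ (ξ + η) y = wave ħ ξ y * wave ħ η y := by
  rw [wave, wave, wave, ← Complex.exp_add, inner_add_left]
  congr 1
  push_cast
  ring

theorem wave_add_right (ħ : ℝ) (ξ x y : Rd d) : wave ħ ξ (x + y) = wave ħ ξ x * wave ħ ξ y := by
  rw [wave_comm, wave_add_left, wave_comm ħ x, wave_comm ħ y]

theorem wave_neg_right (ħ : ℝ) (ξ y : Rd d) : wave ħ ξ (-y) = wave ħ (-ξ) y := by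
  rw [wave, wave, inner_neg_left, inner_neg_right]

theorem wave_neg_mul_self (ħ : ℝ) (ξ y : Rd d) : wave ħ (-ξ) y * wave ħ ξ y = 1 := by
  rw [← wave_add_left]
  simp [wave]

theorem wave_neg_eq (ħ : ℝ) (ξ y : Rd d) :
    Complex.exp (-(Complex.I / (ħ : ℂ)) * ((inner ℝ ξ y : ℝ) : ℂ)) = wave ħ (-ξ) y := by
  rw [wave, inner_neg_left]
  push_cast
  ring_nf

theorem continuous_wave (ħ : ℝ) : Continuous fun z : Rd d × Rd d => wave ħ z.1 z.2 := by
  unfold wave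
  fun_prop

theorem conj_normConst (d : ℕ) (ħ : ℝ) : starRingEnd ℂ (normConst d ħ) = normConst d ħ :=
  Complex.conj_ofReal _

theorem normConst_mul_self (d : ℕ) {ħ : ℝ} (hħ : 0 < ħ) :
    normConst d ħ * normConst d ħ = ((((2 * Real.pi * ħ) ^ d)⁻¹ : ℝ) : ℂ) := by
  rw [normConst, ← Complex.ofReal_mul, ← Real.rpow_add (by positivity)]
  congr 1
  rw [← Real.rpow_natCast, ← Real.rpow_neg (by positivity)]
  congr 1
  ring

theorem conj_phaseShift_apply (ħ : ℝ) (x ξ : Rd d) (g : 𝓢(Rd d, ℂ)) (y : Rd d) :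
    conjS (phaseShift ħ x ξ g) y = normConst d ħ * wave ħ (-ξ) y * conjS g (y - x) := by
  rw [conjS_apply, phaseShift_apply, map_mul, map_mul, conj_normConst, conjS_apply, ← conj_wave]
  rfl

/-! ### Fourier inversion -/

theorem fourierS_eq (ħ : ℝ) (hħ : 0 < ħ) (f : 𝓢(Rd d, ℂ)) (ξ : Rd d) :
    fourierS ħ hħ f ξ = normConst d ħ * ∫ y, wave ħ (-ξ) y * f y := by
  rw [fourierS_apply]
  simp_rw [wave_neg_eq]

/-- Rescaling frequencies by 2πħ reduces this to the standard normalization; the Jacobian cancels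
the square of `normConst`. Mere continuity and integrability are assumed because the result is
applied to a bounded continuous function times a window. -/
theorem fourier_inversion {ħ : ℝ} (hħ : 0 < ħ) {F : Rd d → ℂ} (hc : Continuous F)
    (hF : Integrable F) (hG : Integrable fun ξ : Rd d => ∫ y, wave ħ (-ξ) y * F y) (t : Rd d) :
    normConst d ħ * normConst d ħ * ∫ ξ, wave ħ ξ t * ∫ y, wave ħ (-ξ) y * F y = F t := by
  have hR : (2 * Real.pi * ħ) ≠ 0 := by positivity
  have hR' : (2 * Real.pi * ħ)⁻¹ ≠ 0 := by positivity
  have hħc : (ħ : ℂ) ≠ 0 := by exact_mod_cast hħ.ne'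
  have hp : (Real.pi : ℂ) ≠ 0 := by exact_mod_cast Real.pi_ne_zero
  have h1 : ∀ ξ : Rd d, ∫ y, wave ħ (-ξ) y * F y
      = FourierTransform.fourier F ((2 * Real.pi * ħ)⁻¹ • ξ) := by
    intro ξ
    rw [Real.fourier_eq']
    refine integral_congr_ae (Filter.Eventually.of_forall fun y => ?_)
    simp only [inner_smul_right, smul_eq_mul, real_inner_comm ξ y]
    rw [wave, inner_neg_left]
    congr 2
    push_cast
    field_simp
  simp_rw [h1] at hG ⊢
  have hG' : Integrable (FourierTransform.fourier F) := by
    have := (integrable_comp_smul_iff volume (FourierTransform.fourier F) hR').1 hG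
    exact this
  have h2 := congrFun (hc.fourierInv_fourier_eq hF hG') t
  rw [Real.fourierInv_eq'] at h2
  set H : Rd d → ℂ := fun v => Complex.exp (((2 * Real.pi * inner ℝ v t : ℝ) : ℂ) * Complex.I) •
          FourierTransform.fourier F v with hH
  have h3 : ∀ ξ : Rd d, wave ħ ξ t * FourierTransform.fourier F ((2 * Real.pi * ħ)⁻¹ • ξ)
      = H ((2 * Real.pi * ħ)⁻¹ • ξ) := by
    intro ξ
    simp only [hH]
    simp only [inner_smul_left, smul_eq_mul]
    rw [wave]
    congr 2
    simp
    field_simp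
  simp_rw [h3]
  rw [Measure.integral_comp_smul volume H, normConst_mul_self d hħ, finrank_euclideanSpace, Fintype.card_fin,
    h2, Complex.real_smul, ← mul_assoc, ← Complex.ofReal_mul, inv_pow, inv_inv,
    abs_of_pos (by positivity), inv_mul_cancel₀ (by positivity)]
  simp

/-- The inverse semiclassical Fourier transform. -/
def fourierInvS (ħ : ℝ) (hħ : 0 < ħ) : 𝓢(Rd d, ℂ) →L[ℂ] 𝓢(Rd d, ℂ) :=
  (SchwartzMap.compCLMOfContinuousLinearEquiv ℂ (ContinuousLinearEquiv.neg ℝ)).comp (fourierS ħ hħ)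

theorem fourierInvS_apply (ħ : ℝ) (hħ : 0 < ħ) (f : 𝓢(Rd d, ℂ)) (ξ : Rd d) :
    fourierInvS ħ hħ f ξ = fourierS ħ hħ f (-ξ) := rfl

theorem fourierInvS_eq (ħ : ℝ) (hħ : 0 < ħ) (f : 𝓢(Rd d, ℂ)) (ξ : Rd d) :
    fourierInvS ħ hħ f ξ = normConst d ħ * ∫ y, wave ħ ξ y * f y := by
  rw [fourierInvS_apply, fourierS_eq, neg_neg]

theorem normConst_ne_zero (d : ℕ) {ħ : ℝ} (hħ : 0 < ħ) : normConst d ħ ≠ 0 := by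
  rw [normConst]
  exact_mod_cast (Real.rpow_pos_of_pos (by positivity) _).ne'

theorem fourierInvS_fourierS (ħ : ℝ) (hħ : 0 < ħ) (f : 𝓢(Rd d, ℂ)) :
    fourierInvS ħ hħ (fourierS ħ hħ f) = f := by
  ext t
  rw [fourierInvS_eq]
  have hG : Integrable fun ξ : Rd d => ∫ y, wave ħ (-ξ) y * f y := by
    have h := (fourierS ħ hħ f).integrable (μ := volume)
    refine (h.const_mul (normConst d ħ)⁻¹).congr (Filter.Eventually.of_forall fun ξ => ?_)
    simp only [fourierS_eq]
    rw [inv_mul_cancel_left₀ (normConst_ne_zero d hħ)]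
  rw [← fourier_inversion hħ f.continuous f.integrable hG t, mul_assoc]
  congr 1
  rw [← integral_const_mul]
  congr 1
  funext ξ
  rw [fourierS_eq, wave_comm]
  ring

theorem fourierS_fourierInvS (ħ : ℝ) (hħ : 0 < ħ) (f : 𝓢(Rd d, ℂ)) :
    fourierS ħ hħ (fourierInvS ħ hħ f) = f := by
  conv_rhs => rw [← fourierInvS_fourierS ħ hħ f]
  ext t
  rw [fourierInvS_eq, fourierS_eq, ← integral_neg_eq_self]
  simp_rw [wave_neg_right, neg_neg, fourierInvS_apply, neg_neg]

/-! ### Translations and modulations -/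

theorem fourierS_translate (ħ : ℝ) (hħ : 0 < ħ) (a : Rd d) (b : 𝓢(Rd d, ℂ)) (η : Rd d) :
    fourierS ħ hħ (SchwartzMap.compSubConstCLM ℂ a b) η
      = wave ħ (-η) a * fourierS ħ hħ b η := by
  rw [fourierS_eq, fourierS_eq, ← integral_add_right_eq_self _ a]
  have h : ∀ y, wave ħ (-η) (y + a) * SchwartzMap.compSubConstCLM ℂ a b (y + a)
      = wave ħ (-η) a * (wave ħ (-η) y * b y) := by
    intro y
    rw [SchwartzMap.compSubConstCLM_apply, add_sub_cancel_right, wave_add_right]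
    ring
  simp_rw [h, integral_const_mul]
  ring

/-- Modulation is translation conjugated by the Fourier transform, so continuity and polynomial
growth in ξ are inherited from translations. -/
theorem conj_phaseShift_eq (ħ : ℝ) (hħ : 0 < ħ) (x ξ : Rd d) (g : 𝓢(Rd d, ℂ)) :
    conjS (phaseShift ħ x ξ g) = normConst d ħ • fourierS ħ hħ (SchwartzMap.compSubConstCLM ℂ ξ
      (fourierInvS ħ hħ (SchwartzMap.compSubConstCLM ℂ x (conjS g)))) := by
  ext y
  rw [conj_phaseShift_apply, smul_apply, fourierS_translate, fourierS_fourierInvS,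
    SchwartzMap.compSubConstCLM_apply, smul_eq_mul, mul_assoc, wave_comm ħ (-y), wave_neg_right]

theorem continuous_conj_phaseShift_right {ħ : ℝ} (hħ : 0 < ħ) (x : Rd d) (g : 𝓢(Rd d, ℂ)) :
    Continuous fun ξ => conjS (phaseShift ħ x ξ g) := by
  simp_rw [conj_phaseShift_eq ħ hħ]
  exact (((normConst d ħ) • fourierS ħ hħ).continuous.comp
    (SchwartzMap.continuous_compSubConstCLM _))

theorem continuous_conj_phaseShift_left (ħ : ℝ) (ξ : Rd d) (g : 𝓢(Rd d, ℂ)) :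
    Continuous fun x => conjS (phaseShift ħ x ξ g) :=
  conjS.continuous.comp ((SchwartzMap.smulLeftCLM ℂ _).continuous.comp
    (SchwartzMap.continuous_compSubConstCLM g))

theorem continuous_stft_left (ħ : ℝ) (g : 𝓢(Rd d, ℂ)) (u : 𝓢'(Rd d, ℂ)) (ξ : Rd d) :
    Continuous fun x => stft ħ g u x ξ :=
  u.cont.comp (continuous_conj_phaseShift_left ħ ξ g)

theorem continuous_stft_right {ħ : ℝ} (hħ : 0 < ħ) (g : 𝓢(Rd d, ℂ)) (u : 𝓢'(Rd d, ℂ)) (x : Rd d) :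
    Continuous fun ξ => stft ħ g u x ξ :=
  u.cont.comp (continuous_conj_phaseShift_right hħ x g)

/-- Separate continuity in the two variables is enough for joint measurability. -/
theorem measurable_stft {ħ : ℝ} (hħ : 0 < ħ) (g : 𝓢(Rd d, ℂ)) (u : 𝓢'(Rd d, ℂ)) :
    Measurable fun z : Rd d × Rd d => stft ħ g u z.1 z.2 :=
  measurable_uncurry_of_continuous_of_measurable (u := fun x ξ => stft ħ g u x ξ)
    (fun ξ => continuous_stft_left ħ g u ξ) (fun x => (continuous_stft_right hħ g u x).measurable)

/-! ### Inversion formula for a single window -/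

theorem integrable_one_add_norm_pow_inv (d : ℕ) :
    Integrable fun x : Rd d => ((1 + ‖x‖) ^ (d + 1))⁻¹ := by
  have h := integrable_one_add_norm (E := Rd d) (μ := volume) (r := ((d + 1 : ℕ) : ℝ))
    (by rw [finrank_euclideanSpace, Fintype.card_fin]; exact_mod_cast Nat.lt_succ_self d)
  refine h.congr (Filter.Eventually.of_forall fun x => ?_)
  simp only
  rw [Real.rpow_neg (by positivity), Real.rpow_natCast]

theorem integrable_norm_mul_one_add_norm_pow (φ : 𝓢(Rd d, ℂ)) (m : ℕ) :
    Integrable fun x => ‖φ x‖ * (1 + ‖x‖) ^ m := by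
  obtain ⟨C, hC0, hC⟩ := SchwartzMap.exists_one_add_pow_mul_iteratedFDeriv_le φ (m + (d + 1)) 0
  refine ((integrable_one_add_norm_pow_inv d).const_mul C).mono'
    (φ.continuous.norm.mul (by fun_prop)).aestronglyMeasurable
    (Filter.Eventually.of_forall fun x => ?_)
  have h := hC 0 le_rfl x
  rw [norm_iteratedFDeriv_zero, pow_add] at h
  rw [Real.norm_of_nonneg (by positivity), ← div_eq_mul_inv, le_div_iff₀ (by positivity)]
  linarith

/-- The action of a tempered distribution on a Schwartz function, as a continuous functional. -/
def toCLM (u : 𝓢'(Rd d, ℂ)) : 𝓢(Rd d, ℂ) →L[ℂ] ℂ := u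

theorem toCLM_apply (u : 𝓢'(Rd d, ℂ)) (φ : 𝓢(Rd d, ℂ)) : toCLM u φ = u φ := rfl

/-- The argument of `u` on the left is the superposition over ξ of the conjugated phase space shifts
with weights φ(ξ). It converges in every seminorm: φ decays rapidly, while the shifts grow
polynomially in ξ. -/
theorem apply_mulS_fourierS {ħ : ℝ} (hħ : 0 < ħ) (u : 𝓢'(Rd d, ℂ)) (g φ : 𝓢(Rd d, ℂ)) (x : Rd d) :
    u (mulS (SchwartzMap.compSubConstCLM ℂ x (conjS g)) (fourierS ħ hħ φ))
      = ∫ ξ, φ ξ * stft ħ g u x ξ := by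
  have hK : Continuous fun ξ => φ ξ • conjS (phaseShift ħ x ξ g) :=
    φ.continuous.smul (continuous_conj_phaseShift_right hħ x g)
  refine (SchwartzMap.integral_comp_comm (μ := volume) hK (fun k n => ?_) (fun y => ?_)
    (toCLM u)).2.trans ?_
  · obtain ⟨C, m, hC0, hC⟩ := SchwartzMap.continuousSeminorm_compSubConstCLM_le
      ((SchwartzMap.seminorm ℂ k n).comp (normConst d ħ • fourierS ħ hħ).toLinearMap)
      (((schwartz_withSeminorms ℂ (Rd d) ℂ).continuous_seminorm (k, n)).comp
        (normConst d ħ • fourierS ħ hħ).continuous)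
      (fourierInvS ħ hħ (SchwartzMap.compSubConstCLM ℂ x (conjS g)))
    refine ((integrable_norm_mul_one_add_norm_pow φ m).const_mul C).mono'
      (((schwartz_withSeminorms ℂ (Rd d) ℂ).continuous_seminorm (k, n)).comp
        hK).aestronglyMeasurable (Filter.Eventually.of_forall fun ξ => ?_)
    rw [Real.norm_of_nonneg (apply_nonneg _ _), map_smul_eq_mul, conj_phaseShift_eq ħ hħ]
    have h : SchwartzMap.seminorm ℂ k n (normConst d ħ • fourierS ħ hħ
        (SchwartzMap.compSubConstCLM ℂ ξ
          (fourierInvS ħ hħ (SchwartzMap.compSubConstCLM ℂ x (conjS g))))) ≤ _ := hC ξ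
    calc _ ≤ ‖φ ξ‖ * (C * (1 + ‖ξ‖) ^ m) := by gcongr
      _ = _ := by ring
  · rw [mulS_apply, fourierS_eq, SchwartzMap.compSubConstCLM_apply, ← mul_assoc,
      ← integral_const_mul]
    congr 1
    funext ξ
    rw [smul_apply, smul_eq_mul, conj_phaseShift_apply, wave_comm, wave_neg_right]
    ring
  · congr 1
    funext ξ
    rw [toCLM_apply, map_smul, smul_eq_mul, stft]

/-- The translates of `a` integrate to a constant function, a continuous partition of φ; rapid decay
in x of the localized pieces permits the exchange with `u`. -/
theorem integral_mul_apply {u : 𝓢'(Rd d, ℂ)} (a φ : 𝓢(Rd d, ℂ)) :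
    (∫ y, a y) * u φ = ∫ x, u (mulS (SchwartzMap.compSubConstCLM ℂ x a) φ) := by
  have hK : Continuous fun x : Rd d => mulS (SchwartzMap.compSubConstCLM ℂ x a) φ :=
    (SchwartzMap.continuous_mulS_left φ).comp (SchwartzMap.continuous_compSubConstCLM a)
  have h := (SchwartzMap.integral_comp_comm (μ := volume) hK (Φ := (∫ y, a y) • φ)
    (fun k n => ?_) (fun y => ?_) (toCLM u)).2
  · rw [map_smul, smul_eq_mul] at h
    exact h
  · obtain ⟨C, hC0, hC⟩ := SchwartzMap.continuousSeminorm_mulS_compSubConstCLM_le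
      (SchwartzMap.seminorm ℂ k n)
      ((schwartz_withSeminorms ℂ (Rd d) ℂ).continuous_seminorm (k, n)) a φ (d + 1)
    refine ((integrable_one_add_norm_pow_inv d).const_mul C).mono'
      (((schwartz_withSeminorms ℂ (Rd d) ℂ).continuous_seminorm (k, n)).comp
        hK).aestronglyMeasurable (Filter.Eventually.of_forall fun x => ?_)
    rw [Real.norm_of_nonneg (apply_nonneg _ _), ← div_eq_mul_inv, le_div_iff₀ (by positivity),
      mul_comm]
    exact hC x
  · simp_rw [mulS_apply, SchwartzMap.compSubConstCLM_apply]
    rw [integral_mul_const, integral_sub_left_eq_self (fun x => a x) volume y]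
    rfl

/-- The square of the `L²` norm of a window. -/
def windowMass (g : 𝓢(Rd d, ℂ)) : ℂ := ∫ y, mulS (conjS g) g y

theorem windowMass_ne_zero {g : 𝓢(Rd d, ℂ)} (hg : g ≠ 0) : windowMass g ≠ 0 := by
  have h1 : ∀ y, mulS (conjS g) g y = ((‖g y‖ ^ 2 : ℝ) : ℂ) := by
    intro y
    rw [mulS_apply, conjS_apply, Complex.conj_mul']
    push_cast
    rfl
  have hi : Integrable fun y => ‖g y‖ ^ 2 := by
    refine ((mulS (conjS g) g).integrable (μ := volume)).norm.congr
      (Filter.Eventually.of_forall fun y => ?_)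
    simp only [h1, Complex.norm_real]
    rw [Real.norm_of_nonneg (by positivity)]
  rw [windowMass]
  simp_rw [h1]
  rw [integral_complex_ofReal]
  intro h0
  have h2 : ∫ y, ‖g y‖ ^ 2 = 0 := by exact_mod_cast h0
  rw [integral_eq_zero_iff_of_nonneg (fun y => by positivity) hi] at h2
  have h3 := (Continuous.ae_eq_iff_eq volume (g.continuous.norm.pow 2) continuous_zero).1 h2
  refine hg (SchwartzMap.ext fun y => ?_)
  simpa using congrFun h3 y

/-- Weak inversion formula for the Gabor transform. -/
theorem windowMass_mul_apply {ħ : ℝ} (hħ : 0 < ħ) (u : 𝓢'(Rd d, ℂ)) (g φ : 𝓢(Rd d, ℂ)) :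
    windowMass g * u φ = ∫ x, ∫ ξ,
      fourierInvS ħ hħ (mulS (SchwartzMap.compSubConstCLM ℂ x g) φ) ξ * stft ħ g u x ξ := by
  rw [windowMass, integral_mul_apply]
  congr 1
  funext x
  -- The translate of |g|² splits: conj(g) serves as analysis window, while g is absorbed into the
  -- test function.
  rw [← apply_mulS_fourierS hħ, fourierS_fourierInvS]
  congr 1
  ext y
  simp only [mulS_apply, SchwartzMap.compSubConstCLM_apply]
  ring

/-! ### Independence of the window -/

/-- Covariance: up to a phase, the cross term of two windows depends only on the differences of
positions and of frequencies. This gives the change of window its convolution structure. -/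
theorem fourierInvS_mulS_conj_phaseShift {ħ : ℝ} (hħ : 0 < ħ) (g h : 𝓢(Rd d, ℂ))
    (x x' ξ η : Rd d) :
    fourierInvS ħ hħ (mulS (SchwartzMap.compSubConstCLM ℂ x' g) (conjS (phaseShift ħ x ξ h))) η
      = normConst d ħ * wave ħ (η - ξ) x *
        fourierInvS ħ hħ (mulS (SchwartzMap.compSubConstCLM ℂ (x' - x) g) (conjS h)) (η - ξ) := by
  rw [fourierInvS_eq, fourierInvS_eq, ← integral_add_right_eq_self _ x]
  have h1 : ∀ y, wave ħ η (y + x) * mulS (SchwartzMap.compSubConstCLM ℂ x' g)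
        (conjS (phaseShift ħ x ξ h)) (y + x)
      = normConst d ħ * wave ħ (η - ξ) x * (wave ħ (η - ξ) y *
        mulS (SchwartzMap.compSubConstCLM ℂ (x' - x) g) (conjS h) y) := by
    intro y
    simp only [mulS_apply, SchwartzMap.compSubConstCLM_apply, conj_phaseShift_apply,
      add_sub_cancel_right, sub_eq_add_neg η ξ, wave_add_left, wave_add_right]
    rw [show y + x - x' = y - (x' - x) by abel]
    ring
  simp_rw [h1, integral_const_mul]
  ring

/-- Decay in w holds for every continuous seminorm of the product. The seminorm chosen is the one
measuring decay of order m in ζ of its inverse Fourier transform, so both decays hold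
simultaneously. -/
theorem exists_norm_fourierInvS_mulS_le {ħ : ℝ} (hħ : 0 < ħ) (a b : 𝓢(Rd d, ℂ)) (m : ℕ) :
    ∃ C, 0 ≤ C ∧ ∀ w ζ,
      ‖fourierInvS ħ hħ (mulS (SchwartzMap.compSubConstCLM ℂ w a) b) ζ‖
        ≤ C * (((1 + ‖w‖) ^ m)⁻¹ * ((1 + ‖ζ‖) ^ m)⁻¹) := by
  obtain ⟨C, hC0, hC⟩ := SchwartzMap.continuousSeminorm_mulS_compSubConstCLM_le
    (((Finset.Iic (m, 0)).sup (schwartzSeminormFamily ℂ (Rd d) ℂ)).comp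
      (fourierInvS ħ hħ).toLinearMap)
    ((Seminorm.continuous_finsetSup fun i _ =>
      (schwartz_withSeminorms ℂ (Rd d) ℂ).continuous_seminorm i).comp
      (fourierInvS ħ hħ).continuous) a b m
  refine ⟨2 ^ m * C, by positivity, fun w ζ => ?_⟩
  have h1 := SchwartzMap.one_add_le_sup_seminorm_apply (𝕜 := ℂ) (m := (m, 0)) le_rfl le_rfl
    (fourierInvS ħ hħ (mulS (SchwartzMap.compSubConstCLM ℂ w a) b)) ζ
  rw [norm_iteratedFDeriv_zero] at h1
  have h2 := hC w
  rw [← mul_inv, ← div_eq_mul_inv, le_div_iff₀ (by positivity)]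
  calc _ = (1 + ‖w‖) ^ m * ((1 + ‖ζ‖) ^ m *
        ‖fourierInvS ħ hħ (mulS (SchwartzMap.compSubConstCLM ℂ w a) b) ζ‖) := by ring
    _ ≤ (1 + ‖w‖) ^ m * _ := by gcongr
    _ = 2 ^ m * ((1 + ‖w‖) ^ m * _) := mul_left_comm _ _ _
    _ ≤ _ := by gcongr; exact h2

/-- The supremum over all positions of the modulus of the Gabor transform. -/
def stftSup (ħ : ℝ) (g : 𝓢(Rd d, ℂ)) (u : 𝓢'(Rd d, ℂ)) (ξ : Rd d) : ℝ≥0∞ :=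
  ⨆ x, ‖stft ħ g u x ξ‖ₑ

/-- The supremum is over an uncountable family, but a supremum of continuous functions is lower
semicontinuous. -/
theorem measurable_stftSup {ħ : ℝ} (hħ : 0 < ħ) (g : 𝓢(Rd d, ℂ)) (u : 𝓢'(Rd d, ℂ)) :
    Measurable (stftSup ħ g u) := by
  have h : LowerSemicontinuous (stftSup ħ g u) :=
    lowerSemicontinuous_iSup fun x =>
      ((continuous_stft_right hħ g u x).enorm).lowerSemicontinuous
  exact h.measurable

theorem enorm_stft_le_stftSup (ħ : ℝ) (g : 𝓢(Rd d, ℂ)) (u : 𝓢'(Rd d, ℂ)) (x ξ : Rd d) :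
    ‖stft ħ g u x ξ‖ₑ ≤ stftSup ħ g u ξ :=
  le_iSup (fun x => ‖stft ħ g u x ξ‖ₑ) x

theorem sjostrandNorm_eq (ħ : ℝ) (g : 𝓢(Rd d, ℂ)) (u : 𝓢'(Rd d, ℂ)) :
    sjostrandNorm ħ g u = ∫⁻ ξ, stftSup ħ g u ξ := rfl

/-- The Sjöstrand norm with respect to any window is finite as soon as it is finite for one
non-zero window. -/
theorem sjostrandNorm_lt_top {ħ : ℝ} (hħ : 0 < ħ) {g : 𝓢(Rd d, ℂ)} (hg : g ≠ 0)
    {u : 𝓢'(Rd d, ℂ)} (hu : sjostrandNorm ħ g u < ∞) (h : 𝓢(Rd d, ℂ)) :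
    sjostrandNorm ħ h u < ∞ := by
  obtain ⟨C, hC0, hC⟩ := exists_norm_fourierInvS_mulS_le hħ g (conjS h) (d + 1)
  set P : Rd d → ℝ≥0∞ := fun w => ENNReal.ofReal (((1 + ‖w‖) ^ (d + 1))⁻¹) with hP
  have hPm : Measurable P := by
    rw [hP]
    fun_prop
  have hPfin : ∫⁻ w, P w < ∞ := by
    have h1 := (integrable_one_add_norm_pow_inv d).hasFiniteIntegral
    rw [hasFiniteIntegral_iff_ofReal (Filter.Eventually.of_forall fun x => by positivity)] at h1
    exact h1
  set D : ℝ≥0∞ := ‖normConst d ħ‖ₑ * ENNReal.ofReal C with hD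
  have hDfin : D < ∞ := ENNReal.mul_lt_top (by simp) (by simp)
  set S := stftSup ħ g u with hS
  have hSm : Measurable S := measurable_stftSup hħ g u
  have hpt : ∀ x x' ξ η, ‖fourierInvS ħ hħ (mulS (SchwartzMap.compSubConstCLM ℂ x' g)
      (conjS (phaseShift ħ x ξ h))) η‖ₑ ≤ D * (P (x' - x) * P (η - ξ)) := by
    intro x x' ξ η
    rw [fourierInvS_mulS_conj_phaseShift, enorm_mul, enorm_mul, hD, mul_assoc, mul_assoc]
    refine mul_le_mul_right ?_ _
    have hw : ‖wave ħ (η - ξ) x‖ₑ = 1 := by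
      rw [← ofReal_norm, norm_wave, ENNReal.ofReal_one]
    rw [hw, one_mul, ← ofReal_norm, ← ENNReal.ofReal_mul (by positivity),
      ← ENNReal.ofReal_mul hC0]
    exact ENNReal.ofReal_le_ofReal (hC _ _)
  have hN : ‖windowMass g‖ₑ ≠ 0 := by simpa using windowMass_ne_zero hg
  -- Weak inversion with window `g` is tested on the shifted window `h`. Integrating the position
  -- kernel removes x, so the bound is uniform in x and is a convolution in frequency.
  have hbound : ∀ x ξ, ‖windowMass g‖ₑ * ‖stft ħ h u x ξ‖ₑ
      ≤ D * (∫⁻ w, P w) * ∫⁻ η, P (η - ξ) * S η := by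
    intro x ξ
    rw [← enorm_mul, stft, windowMass_mul_apply hħ u g]
    calc _ ≤ ∫⁻ x', ‖∫ η, fourierInvS ħ hħ (mulS (SchwartzMap.compSubConstCLM ℂ x' g)
            (conjS (phaseShift ħ x ξ h))) η * stft ħ g u x' η‖ₑ := enorm_integral_le_lintegral_enorm _
      _ ≤ ∫⁻ x', D * P (x' - x) * ∫⁻ η, P (η - ξ) * S η := by
        refine lintegral_mono fun x' => (enorm_integral_le_lintegral_enorm _).trans ?_
        rw [← lintegral_const_mul _ (by fun_prop)]
        refine lintegral_mono fun η => ?_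
        rw [enorm_mul]
        calc _ ≤ D * (P (x' - x) * P (η - ξ)) * S η :=
              mul_le_mul' (hpt x x' ξ η) (enorm_stft_le_stftSup ħ g u x' η)
          _ = _ := by ring
      _ = _ := by
        rw [lintegral_mul_const _ (by fun_prop), lintegral_const_mul _ (by fun_prop),
          lintegral_sub_right_eq_self P x]
  rw [sjostrandNorm_eq]
  calc ∫⁻ ξ, stftSup ħ h u ξ
      ≤ ∫⁻ ξ, ‖windowMass g‖ₑ⁻¹ * (D * (∫⁻ w, P w) * ∫⁻ η, P (η - ξ) * S η) := by
        refine lintegral_mono fun ξ => iSup_le fun x => ?_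
        rw [← ENNReal.div_eq_inv_mul, ENNReal.le_div_iff_mul_le (Or.inl hN) (Or.inl (by simp)),
          mul_comm]
        exact hbound x ξ
    _ = ‖windowMass g‖ₑ⁻¹ * (D * (∫⁻ w, P w) * ∫⁻ ξ, ∫⁻ η, P (η - ξ) * S η) := by
        rw [lintegral_const_mul, lintegral_const_mul]
        · exact Measurable.lintegral_prod_right' (f := fun z : Rd d × Rd d => P (z.2 - z.1) * S z.2)
            (by fun_prop)
        · exact (Measurable.lintegral_prod_right'
            (f := fun z : Rd d × Rd d => P (z.2 - z.1) * S z.2) (by fun_prop)).const_mul _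
    -- Tonelli factors the integral of the convolution of `P` and `S`.
    _ = ‖windowMass g‖ₑ⁻¹ * (D * (∫⁻ w, P w) * ((∫⁻ w, P w) * ∫⁻ η, S η)) := by
        rw [lintegral_lintegral_swap (by fun_prop)]
        congr 2
        rw [← lintegral_const_mul _ hSm]
        congr 1
        funext η
        rw [lintegral_mul_const _ (by fun_prop), lintegral_sub_left_eq_self P η]
    _ < ∞ := by
        refine ENNReal.mul_lt_top (ENNReal.inv_lt_top.2 (pos_iff_ne_zero.2 hN))
          (ENNReal.mul_lt_top (ENNReal.mul_lt_top hDfin hPfin) (ENNReal.mul_lt_top hPfin hu))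

/-! ### The bounded continuous function given by an element of the Sjöstrand class -/

theorem measurable_wave (ħ : ℝ) : Measurable fun z : Rd d × Rd d => wave ħ z.1 z.2 :=
  (continuous_wave ħ).measurable

/-- The integrand of the Gabor synthesis formula at the point `y`. -/
def synthesisKernel (ħ : ℝ) (g : 𝓢(Rd d, ℂ)) (u : 𝓢'(Rd d, ℂ)) (y : Rd d) (z : Rd d × Rd d) : ℂ :=
  normConst d ħ * stft ħ g u (y - z.1) z.2 * wave ħ z.2 y * g z.1

/-- An integrable bound for `synthesisKernel`. -/
def synthesisBound (ħ : ℝ) (g : 𝓢(Rd d, ℂ)) (u : 𝓢'(Rd d, ℂ)) (z : Rd d × Rd d) : ℝ :=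
  ‖normConst d ħ‖ * (‖g z.1‖ * (stftSup ħ g u z.2).toReal)

theorem measurable_synthesisKernel {ħ : ℝ} (hħ : 0 < ħ) (g : 𝓢(Rd d, ℂ)) (u : 𝓢'(Rd d, ℂ)) :
    Measurable fun p : Rd d × (Rd d × Rd d) => synthesisKernel ħ g u p.1 p.2 := by
  unfold synthesisKernel
  refine ((measurable_const.mul ?_).mul ?_).mul (g.continuous.measurable.comp (by fun_prop))
  · have h : Measurable fun p : Rd d × (Rd d × Rd d) => (p.1 - p.2.1, p.2.2) := by fun_prop
    have h2 := (measurable_stft hħ g u).comp h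
    simpa only [Function.comp_def] using h2
  · have h : Measurable fun p : Rd d × (Rd d × Rd d) => (p.2.2, p.1) := by fun_prop
    have h2 := (measurable_wave ħ).comp h
    simpa only [Function.comp_def] using h2

theorem integrable_toReal_stftSup {ħ : ℝ} (hħ : 0 < ħ) {g : 𝓢(Rd d, ℂ)} {u : 𝓢'(Rd d, ℂ)}
    (hu : sjostrandNorm ħ g u < ∞) : Integrable fun ξ => (stftSup ħ g u ξ).toReal :=
  integrable_toReal_of_lintegral_ne_top (measurable_stftSup hħ g u).aemeasurable hu.ne

/-- Frequencies with infinite supremum must be excluded, since `toReal` sends ∞ to 0; they form a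
null set. -/
theorem ae_norm_stft_le {ħ : ℝ} (hħ : 0 < ħ) {g : 𝓢(Rd d, ℂ)} {u : 𝓢'(Rd d, ℂ)}
    (hu : sjostrandNorm ħ g u < ∞) :
    ∀ᵐ ξ, ∀ x, ‖stft ħ g u x ξ‖ ≤ (stftSup ħ g u ξ).toReal := by
  filter_upwards [ae_lt_top (measurable_stftSup hħ g u) hu.ne] with ξ hξ x
  rw [← toReal_enorm]
  exact ENNReal.toReal_mono hξ.ne (enorm_stft_le_stftSup ħ g u x ξ)

theorem integrable_synthesisBound {ħ : ℝ} (hħ : 0 < ħ) {g : 𝓢(Rd d, ℂ)} {u : 𝓢'(Rd d, ℂ)}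
    (hu : sjostrandNorm ħ g u < ∞) : Integrable (synthesisBound ħ g u) :=
  (g.integrable.norm.mul_prod (integrable_toReal_stftSup hħ hu)).const_mul _

/-- With z.1 measured relative to y, the point y enters only through a plane wave and the position
in the Gabor transform. The supremum over positions removes it, so one bound and one null set serve
all y. -/
theorem ae_norm_synthesisKernel_le {ħ : ℝ} (hħ : 0 < ħ) {g : 𝓢(Rd d, ℂ)} {u : 𝓢'(Rd d, ℂ)}
    (hu : sjostrandNorm ħ g u < ∞) :
    ∀ᵐ z, ∀ y, ‖synthesisKernel ħ g u y z‖ ≤ synthesisBound ħ g u z := by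
  have h := (Measure.quasiMeasurePreserving_snd (μ := (volume : Measure (Rd d)))
    (ν := (volume : Measure (Rd d)))).ae (ae_norm_stft_le hħ hu)
  filter_upwards [h] with z hz y
  rw [synthesisKernel, synthesisBound, norm_mul, norm_mul, norm_mul, norm_wave, mul_one, mul_assoc,
    mul_comm ‖stft _ _ _ _ _‖]
  gcongr
  exact hz _

theorem integrable_synthesisKernel {ħ : ℝ} (hħ : 0 < ħ) {g : 𝓢(Rd d, ℂ)} {u : 𝓢'(Rd d, ℂ)}
    (hu : sjostrandNorm ħ g u < ∞) (y : Rd d) : Integrable (synthesisKernel ħ g u y) :=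
  (integrable_synthesisBound hħ hu).mono'
    ((measurable_synthesisKernel hħ g u).comp measurable_prodMk_left).aestronglyMeasurable
    ((ae_norm_synthesisKernel_le hħ hu).mono fun _ hz => hz y)

theorem integral_norm_synthesisKernel_le {ħ : ℝ} (hħ : 0 < ħ) {g : 𝓢(Rd d, ℂ)} {u : 𝓢'(Rd d, ℂ)}
    (hu : sjostrandNorm ħ g u < ∞) (y : Rd d) :
    ∫ z, ‖synthesisKernel ħ g u y z‖ ≤ ∫ z, synthesisBound ħ g u z :=
  integral_mono_ae (integrable_synthesisKernel hħ hu y).norm (integrable_synthesisBound hħ hu)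
    ((ae_norm_synthesisKernel_le hħ hu).mono fun _ hz => hz y)

/-- The bounded continuous function given by the Gabor synthesis formula. -/
def synthesis {ħ : ℝ} (hħ : 0 < ħ) {g : 𝓢(Rd d, ℂ)} {u : 𝓢'(Rd d, ℂ)}
    (hu : sjostrandNorm ħ g u < ∞) : Rd d →ᵇ ℂ :=
  BoundedContinuousFunction.ofNormedAddCommGroup
    (fun y => (windowMass g)⁻¹ * ∫ z, synthesisKernel ħ g u y z)
    (continuous_const.mul (continuous_of_dominated
      (fun y => (integrable_synthesisKernel hħ hu y).aestronglyMeasurable)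
      (fun y => (ae_norm_synthesisKernel_le hħ hu).mono fun _ hz => hz y)
      (integrable_synthesisBound hħ hu)
      (Filter.Eventually.of_forall fun z => by
        unfold synthesisKernel
        refine ((continuous_const.mul ?_).mul ?_).mul continuous_const
        · exact (continuous_stft_left ħ g u z.2).comp (continuous_id.sub continuous_const)
        · exact (continuous_wave ħ).comp (by fun_prop : Continuous fun y : Rd d => (z.2, y)))))
    (‖(windowMass g)⁻¹‖ * ∫ z, synthesisBound ħ g u z) (fun y => by
      rw [norm_mul]
      gcongr
      exact (norm_integral_le_integral_norm _).trans (integral_norm_synthesisKernel_le hħ hu y))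

theorem synthesis_apply {ħ : ℝ} (hħ : 0 < ħ) {g : 𝓢(Rd d, ℂ)} {u : 𝓢'(Rd d, ℂ)}
    (hu : sjostrandNorm ħ g u < ∞) (y : Rd d) :
    synthesis hħ hu y = (windowMass g)⁻¹ * ∫ z, synthesisKernel ħ g u y z := rfl

/-- Reflection of the first variable about the point `y`. -/
def reflectFst (y : Rd d) : (Rd d × Rd d) ≃ᵐ (Rd d × Rd d) :=
  (MeasurableEquiv.subLeft y).prodCongr (MeasurableEquiv.refl _)

theorem reflectFst_apply (y : Rd d) (z : Rd d × Rd d) : reflectFst y z = (y - z.1, z.2) := rfl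

theorem measurePreserving_reflectFst (y : Rd d) : MeasurePreserving (reflectFst y) :=
  (Measure.measurePreserving_sub_left volume y).prod (MeasurePreserving.id volume)

theorem isGivenBy_synthesis {ħ : ℝ} (hħ : 0 < ħ) {g : 𝓢(Rd d, ℂ)} (hg : g ≠ 0)
    {u : 𝓢'(Rd d, ℂ)} (hu : sjostrandNorm ħ g u < ∞) : IsGivenBy u (synthesis hħ hu) := by
  intro φ
  have hN := windowMass_ne_zero hg
  -- Reflection returns to absolute positions x = y - z.1, so that the y-integral at fixed (x, ξ) is
  -- the inverse Fourier transform in the weak inversion formula.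
  set H : Rd d × (Rd d × Rd d) → ℂ :=
    fun p => synthesisKernel ħ g u p.1 (reflectFst p.1 p.2) * φ p.1 with hH
  have hHm : Measurable H := by
    refine Measurable.mul ?_ (φ.continuous.measurable.comp measurable_fst)
    have h : Measurable fun p : Rd d × (Rd d × Rd d) => (p.1, (p.1 - p.2.1, p.2.2)) := by fun_prop
    have h2 := (measurable_synthesisKernel hħ g u).comp h
    simpa only [Function.comp_def, reflectFst_apply] using h2
  have hHnorm : ∀ y, ∫ z, ‖H (y, z)‖ = (∫ z, ‖synthesisKernel ħ g u y z‖) * ‖φ y‖ := by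
    intro y
    simp only [hH, norm_mul]
    rw [integral_mul_const, (measurePreserving_reflectFst y).integral_comp'
      (fun z => ‖synthesisKernel ħ g u y z‖)]
  have hHint : Integrable H := by
    refine (integrable_prod_iff hHm.aestronglyMeasurable).2
      ⟨Filter.Eventually.of_forall fun y => ?_, ?_⟩
    · have h := ((measurePreserving_reflectFst y).integrable_comp_emb
        (reflectFst y).measurableEmbedding).2 (integrable_synthesisKernel hħ hu y)
      simpa only [Function.comp_def, hH] using h.mul_const (φ y)
    · refine ((φ.integrable (μ := volume)).norm.const_mul (∫ z, synthesisBound ħ g u z)).mono'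
        (hHm.norm.stronglyMeasurable.integral_prod_right').aestronglyMeasurable
        (Filter.Eventually.of_forall fun y => ?_)
      rw [hHnorm, Real.norm_of_nonneg (by positivity)]
      exact mul_le_mul_of_nonneg_right (integral_norm_synthesisKernel_le hħ hu y) (norm_nonneg _)
  have hval : ∀ x ξ y, H (y, (x, ξ)) =
      normConst d ħ * stft ħ g u x ξ * (wave ħ ξ y *
        mulS (SchwartzMap.compSubConstCLM ℂ x g) φ y) := by
    intro x ξ y
    simp only [hH, reflectFst_apply, synthesisKernel, mulS_apply, SchwartzMap.compSubConstCLM_apply,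
      sub_sub_cancel]
    ring
  have hleft : windowMass g * u φ = ∫ y, ∫ z, H (y, z) := by
    rw [integral_integral_swap (f := fun y z => H (y, z)) hHint]
    have hswap : Integrable fun z : Rd d × Rd d => ∫ y, H (y, z) := hHint.integral_prod_right
    rw [Measure.volume_eq_prod, integral_prod _ hswap, windowMass_mul_apply hħ u g φ]
    congr 1
    funext x
    congr 1
    funext ξ
    simp_rw [hval, integral_const_mul, fourierInvS_eq]
    ring
  have hright : ∀ y, ∫ z, H (y, z) = windowMass g * (synthesis hħ hu y * φ y) := by
    intro y
    simp only [hH]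
    rw [integral_mul_const, (measurePreserving_reflectFst y).integral_comp'
      (fun z => synthesisKernel ħ g u y z), synthesis_apply]
    field_simp
  simp_rw [hright] at hleft
  rw [integral_const_mul] at hleft
  exact mul_left_cancel₀ hN hleft

/-! ### Gabor transforms of Fourier transforms and of pure tones -/

/-- The Fourier transform interchanges translations and modulations; the phase comes from their
commutation. -/
theorem fourierS_conj_phaseShift {ħ : ℝ} (hħ : 0 < ħ) (g : 𝓢(Rd d, ℂ)) (x ξ : Rd d) :
    fourierS ħ hħ (conjS (phaseShift ħ x ξ g))
      = wave ħ (-ξ) x • conjS (phaseShift ħ (-ξ) x (conjS (fourierS ħ hħ (conjS g)))) := by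
  ext η
  have h1 : ∀ y, wave ħ (-η) y * conjS (phaseShift ħ x ξ g) y
      = normConst d ħ * (wave ħ (-(η + ξ)) y * SchwartzMap.compSubConstCLM ℂ x (conjS g) y) := by
    intro y
    rw [conj_phaseShift_apply, SchwartzMap.compSubConstCLM_apply, neg_add, wave_add_left]
    ring
  rw [fourierS_eq]
  simp_rw [h1, integral_const_mul]
  rw [← fourierS_eq ħ hħ, fourierS_translate, smul_apply, smul_eq_mul, conj_phaseShift_apply,
    conjS_apply, conjS_apply, Complex.conj_conj, sub_neg_eq_add, neg_add, wave_add_left,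
    wave_comm ħ (-x), wave_neg_right]
  ring

theorem stft_fourierD {ħ : ℝ} (hħ : 0 < ħ) (g : 𝓢(Rd d, ℂ)) (u : 𝓢'(Rd d, ℂ)) (x ξ : Rd d) :
    stft ħ g (fourierD ħ hħ u) x ξ
      = wave ħ (-ξ) x * stft ħ (conjS (fourierS ħ hħ (conjS g))) u (-ξ) x := by
  rw [stft, fourierD_apply, fourierS_conj_phaseShift, map_smul, smul_eq_mul, stft]

theorem pureToneDist_apply (ħ : ℝ) (ω : Rd d) (φ : 𝓢(Rd d, ℂ)) :
    pureToneDist ħ ω φ = ∫ y, φ y * (normConst d ħ * wave ħ ω y) := by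
  exact Function.HasTemperateGrowth.toTemperedDistribution_apply
    volume (pureTone_hasTemperateGrowth ħ ω) φ

theorem conjD_pureToneDist (ħ : ℝ) (ω : Rd d) :
    conjD (pureToneDist ħ ω) = pureToneDist ħ (-ω) := by
  ext φ
  rw [conjD_apply, pureToneDist_apply, pureToneDist_apply, ← integral_conj]
  congr 1
  funext y
  rw [map_mul, map_mul, conj_normConst, conj_wave, conjS_apply, Complex.conj_conj]

theorem stftConj_pureToneDist (ħ : ℝ) (γ : 𝓢(Rd d, ℂ)) (t x ξ : Rd d) :
    stftConj ħ γ (pureToneDist ħ t) x ξ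
      = starRingEnd ℂ (stft ħ γ (pureToneDist ħ (-t)) x ξ) := by
  rw [stftConj, conjD_pureToneDist]

theorem conj_stft_pureToneDist {ħ : ℝ} (hħ : 0 < ħ) (γ : 𝓢(Rd d, ℂ)) (t x ξ : Rd d) :
    starRingEnd ℂ (stft ħ γ (pureToneDist ħ (-t)) x ξ)
      = normConst d ħ * wave ħ (ξ + t) x * fourierInvS ħ hħ γ (ξ + t) := by
  rw [stft, pureToneDist_apply, ← integral_conj, fourierInvS_eq, ← integral_add_right_eq_self _ x]
  have h : ∀ y, starRingEnd ℂ (conjS (phaseShift ħ x ξ γ) (y + x) *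
      (normConst d ħ * wave ħ (-t) (y + x)))
      = normConst d ħ * wave ħ (ξ + t) x * normConst d ħ * (wave ħ (ξ + t) y * γ y) := by
    intro y
    rw [conj_phaseShift_apply, conjS_apply, map_mul, map_mul, map_mul, map_mul, conj_normConst,
      conj_wave, conj_wave, neg_neg, neg_neg, Complex.conj_conj, add_sub_cancel_right,
      wave_add_left, wave_add_left, wave_add_right, wave_add_right]
    ring
  simp_rw [h, integral_const_mul]
  ring

/-- Parseval in bilinear form: Fubini moves the inverse transform from `a` onto the transform of
`b`. -/
theorem integral_fourierInvS_mul_fourierS {ħ : ℝ} (hħ : 0 < ħ) (a b : 𝓢(Rd d, ℂ)) :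
    ∫ ξ, fourierInvS ħ hħ a ξ * fourierS ħ hħ b ξ = ∫ y, a y * b y := by
  set B := fourierS ħ hħ b with hB
  have hint : Integrable fun z : Rd d × Rd d => wave ħ z.1 z.2 * (B z.1 * a z.2) :=
    ((B.integrable (μ := volume)).mul_prod (a.integrable (μ := volume))).bdd_mul (c := 1)
      (continuous_wave ħ).aestronglyMeasurable
      (Filter.Eventually.of_forall fun z => (norm_wave ħ z.1 z.2).le)
  have h1 : ∀ ξ, fourierInvS ħ hħ a ξ * B ξ
      = normConst d ħ * ∫ y, wave ħ ξ y * (B ξ * a y) := by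
    intro ξ
    rw [fourierInvS_eq, mul_assoc, ← integral_mul_const]
    congr 2
    funext y
    ring
  simp_rw [h1]
  rw [integral_const_mul, integral_integral_swap (f := fun ξ y => wave ħ ξ y * (B ξ * a y)) hint,
    ← integral_const_mul]
  congr 1
  funext y
  conv_rhs => rw [← fourierInvS_fourierS ħ hħ b, ← hB, fourierInvS_eq, mul_left_comm,
    ← integral_const_mul]
  congr 2
  funext ξ
  rw [wave_comm]
  ring

/-! ### Pointwise recovery -/

section Recovery

variable {ħ : ℝ} {u : 𝓢'(Rd d, ℂ)} {f : Rd d →ᵇ ℂ}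

/-- The Fourier integral of the Gabor transform in the frequency variable localizes `f`. -/
theorem normConst_mul_integral_wave_mul_stft (hħ : 0 < ħ) (hf : IsGivenBy u f) {h : 𝓢(Rd d, ℂ)}
    (hu : sjostrandNorm ħ h u < ∞) (x t : Rd d) :
    normConst d ħ * ∫ ξ, wave ħ t ξ * stft ħ h u x ξ = f t * conjS h (t - x) := by
  set F : Rd d → ℂ := fun y => f y * conjS h (y - x) with hFdef
  have hFc : Continuous F :=
    f.continuous.mul ((conjS h).continuous.comp (continuous_id.sub continuous_const))
  have hFi : Integrable F :=
    ((SchwartzMap.compSubConstCLM ℂ x (conjS h)).integrable (μ := volume)).bdd_mul (c := ‖f‖)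
      f.continuous.aestronglyMeasurable
      (Filter.Eventually.of_forall fun y => f.norm_coe_le_norm y)
  have hV : ∀ ξ, stft ħ h u x ξ = normConst d ħ * ∫ y, wave ħ (-ξ) y * F y := by
    intro ξ
    rw [stft, hf, ← integral_const_mul]
    congr 1
    funext y
    rw [conj_phaseShift_apply]
    ring
  -- The Sjöstrand condition for the window `h` supplies the integrability that makes Fourier
  -- inversion valid at every point.
  have hVi : Integrable fun ξ => stft ħ h u x ξ :=
    (integrable_toReal_stftSup hħ hu).mono' (continuous_stft_right hħ h u x).aestronglyMeasurable
      ((ae_norm_stft_le hħ hu).mono fun _ hξ => hξ x)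
  have hG : Integrable fun ξ : Rd d => ∫ y, wave ħ (-ξ) y * F y := by
    refine (hVi.const_mul (normConst d ħ)⁻¹).congr (Filter.Eventually.of_forall fun ξ => ?_)
    simp only [hV]
    rw [inv_mul_cancel_left₀ (normConst_ne_zero d hħ)]
  change _ = F t
  rw [← fourier_inversion hħ hFc hFi hG t, mul_assoc]
  congr 1
  rw [← integral_const_mul]
  congr 1
  funext ξ
  rw [hV, wave_comm]
  ring

theorem stft_mul_conj_stft (hħ : 0 < ħ) (u : 𝓢'(Rd d, ℂ)) (g γ : 𝓢(Rd d, ℂ)) (t x ξ : Rd d) :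
    stft ħ g (fourierD ħ hħ u) x ξ * starRingEnd ℂ (stft ħ γ (pureToneDist ħ (-t)) x ξ)
      = normConst d ħ * (wave ħ t x * stft ħ (conjS (fourierS ħ hħ (conjS g))) u (-ξ) x) *
        fourierInvS ħ hħ γ (ξ + t) := by
  rw [stft_fourierD, conj_stft_pureToneDist hħ, wave_add_left]
  linear_combination (normConst d ħ * wave ħ t x *
    stft ħ (conjS (fourierS ħ hħ (conjS g))) u (-ξ) x * fourierInvS ħ hħ γ (ξ + t)) *
    wave_neg_mul_self ħ ξ x

/-- After the rotation of phase space, x is the frequency variable of V_h u. The Sjöstrand norm thus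
gives integrability in x, and the Schwartz decay of the transform of γ gives it in ξ. -/
theorem integrable_stft_mul_conj_stft (hħ : 0 < ħ) (hu : ∀ h, sjostrandNorm ħ h u < ∞) (g γ : 𝓢(Rd d, ℂ))
    (t : Rd d) :
    Integrable fun z : Rd d × Rd d => stft ħ g (fourierD ħ hħ u) z.1 z.2 *
      starRingEnd ℂ (stft ħ γ (pureToneDist ħ (-t)) z.1 z.2) := by
  set h := conjS (fourierS ħ hħ (conjS g)) with hh
  have hΓ : Integrable fun ξ => ‖normConst d ħ‖ * ‖fourierInvS ħ hħ γ (ξ + t)‖ :=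
    (((fourierInvS ħ hħ γ).integrable (μ := volume)).comp_add_right t).norm.const_mul _
  refine ((integrable_toReal_stftSup hħ (hu h)).mul_prod hΓ).mono'
    ((measurable_stft hħ g _).mul
      (Complex.continuous_conj.measurable.comp (measurable_stft hħ γ _))).aestronglyMeasurable ?_
  have hae := (Measure.quasiMeasurePreserving_fst (μ := (volume : Measure (Rd d)))
    (ν := (volume : Measure (Rd d)))).ae (ae_norm_stft_le hħ (hu h))
  filter_upwards [hae] with z hz
  rw [stft_mul_conj_stft hħ, norm_mul, norm_mul, norm_mul, norm_wave, one_mul,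
    mul_comm ‖normConst d ħ‖, mul_assoc]
  exact mul_le_mul_of_nonneg_right (hz _) (by positivity)

theorem integral_stft_mul_conj_stft (hħ : 0 < ħ) (hf : IsGivenBy u f) (hu : ∀ h, sjostrandNorm ħ h u < ∞)
    (g γ : 𝓢(Rd d, ℂ)) (t : Rd d) :
    ∫ z : Rd d × Rd d, stft ħ g (fourierD ħ hħ u) z.1 z.2 *
      starRingEnd ℂ (stft ħ γ (pureToneDist ħ (-t)) z.1 z.2) = f t * pairing γ g := by
  set h := conjS (fourierS ħ hħ (conjS g)) with hh
  -- The x-integral is taken first: at fixed ξ it localizes f at t. The ξ-integral left over is a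
  -- translated Parseval pairing.
  rw [Measure.volume_eq_prod, integral_prod_symm _ (integrable_stft_mul_conj_stft hħ hu g γ t)]
  have h1 : ∀ ξ, ∫ x, stft ħ g (fourierD ħ hħ u) x ξ *
      starRingEnd ℂ (stft ħ γ (pureToneDist ħ (-t)) x ξ)
      = f t * (fourierInvS ħ hħ γ (ξ + t) * fourierS ħ hħ (conjS g) (ξ + t)) := by
    intro ξ
    simp_rw [stft_mul_conj_stft hħ]
    rw [integral_mul_const, integral_const_mul,
      normConst_mul_integral_wave_mul_stft hħ hf (hu _) (-ξ) t, conjS_apply, conjS_apply,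
      Complex.conj_conj, sub_neg_eq_add, add_comm t ξ]
    ring
  simp_rw [h1]
  rw [integral_const_mul, integral_add_right_eq_self
    (fun ξ => fourierInvS ħ hħ γ ξ * fourierS ħ hħ (conjS g) ξ) t,
    integral_fourierInvS_mul_fourierS]
  rfl

end Recovery

theorem pairing_conj (g γ : 𝓢(Rd d, ℂ)) : starRingEnd ℂ (pairing g γ) = pairing γ g := by
  rw [pairing, pairing, ← integral_conj]
  congr 1
  funext y
  rw [map_mul, Complex.conj_conj, mul_comm]

end Gabor

end

/-- Every `u ∈ M^{∞,1}(ℝ^d)` is (given by) a bounded continuous function `f`, whose value at every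
point is recovered from the Gabor transform of the Fourier transform of `u`, with absolutely
convergent integrals over `ℝ^{2d}`. -/
theorem lemma6p2 (d : ℕ) (ħ : ℝ) (hħ : 0 < ħ) (hħ1 : ħ ≤ 1)
    (u : 𝓢'(Gabor.Rd d, ℂ)) (hu : Gabor.MemSjostrand ħ u) :
    ∃ f : Gabor.Rd d →ᵇ ℂ, Gabor.IsGivenBy u f ∧
      ∀ g γ : 𝓢(Gabor.Rd d, ℂ), Gabor.pairing g γ ≠ 0 → ∀ t : Gabor.Rd d,
        Integrable (fun z : Gabor.Rd d × Gabor.Rd d =>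
          Gabor.stft ħ g (Gabor.fourierD ħ hħ u) z.1 z.2 *
            starRingEnd ℂ (Gabor.stft ħ γ (Gabor.pureToneDist ħ (-t)) z.1 z.2)) ∧
        f t = 1 / Gabor.pairing γ g * (∫ z : Gabor.Rd d × Gabor.Rd d,
          Gabor.stft ħ g (Gabor.fourierD ħ hħ u) z.1 z.2 *
            starRingEnd ℂ (Gabor.stft ħ γ (Gabor.pureToneDist ħ (-t)) z.1 z.2)) ∧
        Integrable (fun z : Gabor.Rd d × Gabor.Rd d =>
          Gabor.stft ħ g (Gabor.fourierD ħ hħ u) z.1 z.2 *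
            Gabor.stftConj ħ γ (Gabor.pureToneDist ħ t) z.1 z.2) ∧
        f t = 1 / Gabor.pairing γ g * (∫ z : Gabor.Rd d × Gabor.Rd d,
          Gabor.stft ħ g (Gabor.fourierD ħ hħ u) z.1 z.2 *
            Gabor.stftConj ħ γ (Gabor.pureToneDist ħ t) z.1 z.2) := by
  obtain ⟨g₀, hg₀, hfin⟩ := hu
  have hall := Gabor.sjostrandNorm_lt_top hħ hg₀ hfin
  have hgiven := Gabor.isGivenBy_synthesis hħ hg₀ hfin
  refine ⟨Gabor.synthesis hħ hfin, hgiven, fun g γ hgγ t => ?_⟩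
  -- The hypothesis concerns ⟨g,γ⟩, while the formula divides by its conjugate ⟨γ,g⟩.
  have hne : Gabor.pairing γ g ≠ 0 := by
    rw [← Gabor.pairing_conj g γ]
    simpa using hgγ
  have hint := Gabor.integrable_stft_mul_conj_stft hħ hall g γ t
  have hval : Gabor.synthesis hħ hfin t = 1 / Gabor.pairing γ g *
      (∫ z : Gabor.Rd d × Gabor.Rd d, Gabor.stft ħ g (Gabor.fourierD ħ hħ u) z.1 z.2 *
        starRingEnd ℂ (Gabor.stft ħ γ (Gabor.pureToneDist ħ (-t)) z.1 z.2)) := by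
    rw [Gabor.integral_stft_mul_conj_stft hħ hgiven hall]
    field_simp
  simp_rw [Gabor.stftConj_pureToneDist]
  exact ⟨hint, hval, hint, hval⟩
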